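/- Let $\hbar>0$ and write $\Omega=(x,p)\in\mathbb R^2$, $d\Omega=dx\,dp$. For $\Omega_0=(x_0,p_0)$ let $\mathcal D(\Omega_0)\psi(x)=e^{\frac i\hbar(p_0x-\frac12p_0x_0)}\psi(x-x_0)$ be the displacement operator, $\mathcal D^\dagger(\Omega_0)=\mathcal D(-\Omega_0)$ its adjoint, and $\Pi\psi(x)=\psi(-x)$ the parity operator; $\mathcal D(\Omega_0)$ acts on $\mathcal S(\mathbb R)$ and, by duality, on $\mathcal S'(\mathbb R)$. Let $$[F_\sigma a](x,p)=(2\pi\hbar)^{-1}\int e^{-\frac i\hbar(x'p-xp')}a(x',p')\,dx'\,dp'$$ be the symplectic Fourier transform, extended to $\mathcal S'(\mathbb R^2)$, and $\theta^\vee(\Omega)=\theta(-\Omega)$. A tempered distribution is called slowly increasing if it is given by a smooth function all of whose derivatives are polynomially bounded. For $a,b\in\mathcal S'(\mathbb R^2)$ such that at least one of $F_\sigma a$, $F_\sigma b$ is slowly increasing, put $a*b=2\pi\hbar\,F_\sigma[(F_\sigma a)(F_\sigma b)]\in\mathcal S'(\mathbb R^2)$. Operators are continuous linear maps $\mathcal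 S(\mathbb R)\to\mathcal S'(\mathbb R)$, and operator integrals are understood weakly, through matrix elements. For $a,\theta\in\mathcal S'(\mathbb R^2)$ define $$\mathrm{Op}_{\mathrm{Weyl}}(a)=(\pi\hbar)^{-1}\int a(\Omega)\,\mathcal D(\Omega)\Pi\mathcal D^\dagger(\Omega)\,d\Omega,\qquad \mathrm{Op}_\theta(a)=\mathrm{Op}_{\mathrm{Weyl}}(a*\theta^\vee)\ \text{ whenever } a*\theta^\vee\text{ is defined},$$ $$\Pi_\theta=(4\pi\hbar)^{-1}\int K_\theta(\Omega)\,\mathcal D(\Omega)\,d\Omega,\qquad K_\theta(\Omega)=2\pi\hbar\,[F_\sigma\theta](-\Omega).$$ Then for every Cohen kernel $\theta\in\mathcal S'(\mathbb R^2)$: (1) For every symbol $a\in\mathcal S'(\mathbb R^2)$ for which $a*\theta^\vee$ is defined, $$\mathrm{Op}_\theta(a)=(\pi\hbar)^{-1}\int a(\Omega)\,\mathcal D(\Omega)\Pi_\theta\mathcal D^\dagger(\Omega)\,d\Omega .$$ Here the matrix elements $g(\Omega)$ of $\mathcal D(\Omega)\Pi_\theta\mathcal D^\dagger(\Omega)$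 between Schwartz functions are smooth, with all derivatives polynomially bounded, and $\int a\,g\,d\Omega$ is the limit as $\varepsilon\to0^+$ of $a$ applied to $\chi(\varepsilon\,\cdot)\,g$, which exists and is the same for all $\chi\in\mathcal S(\mathbb R^2)$ with $\chi(0)=1$. (2) If $F_\sigma\theta$ is slowly increasing, then $\mathrm{Op}_\theta(a)$ is defined for all $a\in\mathcal S'(\mathbb R^2)$, the matrix elements $g$ are Schwartz functions, and the formula in (1) holds with $\int a\,g\,d\Omega$ being the value of $a$ at $g$. (3) Consequently, with $\delta$ the delta distribution at $0\in\mathbb R^2$, $\Pi_\theta=\pi\hbar\,\mathrm{Op}_\theta(\delta)=\pi\hbar\,\mathrm{Op}_{\mathrm{Weyl}}(\theta^\vee)$: the parity operator $\Pi_\theta$ is $\pi\hbar$ times the Weyl quantization of the reflected Cohen kernel. -/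

import Mathlib

open scoped SchwartzMap FourierTransform ContDiff
open MeasureTheory Filter Topology

noncomputable section

namespace CohenQuant

/-- The phase space `ℝ²`; a point `Ω` has position `Ω 0 = x` and momentum `Ω 1 = p`. -/
abbrev Phase : Type := EuclideanSpace ℝ (Fin 2)

/-! ### Auxiliary facts -/

theorem hasTemperateGrowth_cexp_I :
    (fun t : ℝ => Complex.exp (Complex.I * t)).HasTemperateGrowth := by
  have hd : ∀ n : ℕ, iteratedDeriv n (fun t : ℝ => Complex.exp (Complex.I * t))
      = fun t : ℝ => Complex.I ^ n * Complex.exp (Complex.I * t) := by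
    intro n
    induction n with
    | zero => ext t; simp
    | succ n ih =>
      rw [iteratedDeriv_succ, ih]
      ext t
      have h1 : HasDerivAt (fun t : ℝ => Complex.I * (t : ℂ)) (Complex.I * 1) t :=
        (Complex.ofRealCLM.hasDerivAt (x := t)).const_mul Complex.I
      have h2 := (h1.cexp.const_mul (Complex.I ^ n)).deriv
      rw [h2]
      ring
  refine ⟨?_, fun n => ⟨0, 1, fun t => ?_⟩⟩
  · exact Complex.contDiff_exp.comp (contDiff_const.mul Complex.ofRealCLM.contDiff)
  · rw [norm_iteratedFDeriv_eq_norm_iteratedDeriv, hd]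
    rw [norm_mul, norm_pow, Complex.norm_I, mul_comm Complex.I, Complex.norm_exp_ofReal_mul_I]
    simp

theorem hasTemperateGrowth_coord (i : Fin 2) :
    (fun z : Phase => z i).HasTemperateGrowth :=
  (EuclideanSpace.proj (𝕜 := ℝ) i : Phase →L[ℝ] ℝ).hasTemperateGrowth

/-- The chirp `(x, p) ↦ exp (i c x p)`. -/
def chirp (c : ℝ) (z : Phase) : ℂ := Complex.exp (Complex.I * ((c * (z 0 * z 1) : ℝ) : ℂ))

theorem hasTemperateGrowth_chirp (c : ℝ) : (chirp c).HasTemperateGrowth := by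
  have h : (fun z : Phase => c * (z 0 * z 1)).HasTemperateGrowth :=
    (Function.HasTemperateGrowth.const c).mul
      ((hasTemperateGrowth_coord 0).mul (hasTemperateGrowth_coord 1))
  exact hasTemperateGrowth_cexp_I.comp h

theorem norm_iteratedFDeriv_comp_coord (f : 𝓢(ℝ, ℂ)) (i : Fin 2) (n : ℕ) (z : Phase) :
    ‖iteratedFDeriv ℝ n (fun z : Phase => f (z i)) z‖ ≤ ‖iteratedFDeriv ℝ n f (z i)‖ := by
  set P : Phase →L[ℝ] ℝ := EuclideanSpace.proj (𝕜 := ℝ) i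
  have hP : ‖P‖ ≤ 1 := by
    refine ContinuousLinearMap.opNorm_le_bound _ zero_le_one fun z => ?_
    rw [one_mul]
    exact PiLp.norm_apply_le z i
  have h := P.iteratedFDeriv_comp_right (f := f) (f.smooth n) z (i := n) le_rfl
  have h2 : (fun z : Phase => f (z i)) = f ∘ P := rfl
  rw [h2, h]
  refine (ContinuousMultilinearMap.norm_compContinuousLinearMap_le _ _).trans ?_
  have : ∏ _j : Fin n, ‖P‖ ≤ 1 := by
    rw [Finset.prod_const]; exact pow_le_one₀ (norm_nonneg _) hP
  exact mul_le_of_le_one_right (norm_nonneg _) this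

/-- The tensor product `(φ ⊗ ψ)(x, y) = φ x * ψ y`, as a continuous linear map in `φ`. -/
def tensor (ψ : 𝓢(ℝ, ℂ)) : 𝓢(ℝ, ℂ) →L[ℂ] 𝓢(Phase, ℂ) := by
  refine SchwartzMap.mkCLM (fun φ z => φ (z 0) * ψ (z 1)) (fun f g z => ?_) (fun a f z => ?_)
    (fun f => ?_) ?_
  · simp [add_mul]
  · simp [mul_assoc]
  · have h0 : ContDiff ℝ ∞ (fun z : Phase => z 0) := (hasTemperateGrowth_coord 0).1
    have h1 : ContDiff ℝ ∞ (fun z : Phase => z 1) := (hasTemperateGrowth_coord 1).1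
    exact ((f.smooth ⊤).comp h0).mul ((ψ.smooth ⊤).comp h1)
  · rintro ⟨k, n⟩
    set B : ℝ := (2 : ℝ) ^ k * ((Finset.Iic (k, n)).sup fun m => SchwartzMap.seminorm ℂ m.1 m.2) ψ
    have hB : 0 ≤ B := by positivity
    refine ⟨Finset.Iic (k, n), ∑ i ∈ Finset.range (n + 1), (n.choose i : ℝ) * ((2 : ℝ) ^ k * B),
      by positivity, fun f z => ?_⟩
    have h0 : ContDiff ℝ n (fun z : Phase => f (z 0)) :=
      (f.smooth n).comp ((hasTemperateGrowth_coord 0).1.of_le (by exact_mod_cast le_top))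
    have h1 : ContDiff ℝ n (fun z : Phase => ψ (z 1)) :=
      (ψ.smooth n).comp ((hasTemperateGrowth_coord 1).1.of_le (by exact_mod_cast le_top))
    have hmul := norm_iteratedFDeriv_mul_le h0 h1 z (n := n) le_rfl
    have hz : ‖z‖ ^ k ≤ (1 + ‖z 0‖) ^ k * (1 + ‖z 1‖) ^ k := by
      rw [← mul_pow]
      refine pow_le_pow_left₀ (norm_nonneg _) ?_ k
      rw [EuclideanSpace.norm_eq, Fin.sum_univ_two]
      apply Real.sqrt_le_iff.2
      constructor
      · positivity
      · nlinarith [norm_nonneg (z 0), norm_nonneg (z 1),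
          mul_nonneg (norm_nonneg (z 0)) (norm_nonneg (z 1))]
    simp only
    calc ‖z‖ ^ k * ‖iteratedFDeriv ℝ n (fun z : Phase => f (z 0) * ψ (z 1)) z‖
        ≤ ((1 + ‖z 0‖) ^ k * (1 + ‖z 1‖) ^ k) *
          ∑ i ∈ Finset.range (n + 1), (n.choose i : ℝ) *
            ‖iteratedFDeriv ℝ i f (z 0)‖ * ‖iteratedFDeriv ℝ (n - i) ψ (z 1)‖ := by
          refine mul_le_mul hz (hmul.trans ?_) (norm_nonneg _) (by positivity)
          refine Finset.sum_le_sum fun i _ => ?_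
          gcongr
          · exact norm_iteratedFDeriv_comp_coord f 0 i z
          · exact norm_iteratedFDeriv_comp_coord ψ 1 (n - i) z
      _ = ∑ i ∈ Finset.range (n + 1), (n.choose i : ℝ) *
            (((1 + ‖z 0‖) ^ k * ‖iteratedFDeriv ℝ i f (z 0)‖) *
            ((1 + ‖z 1‖) ^ k * ‖iteratedFDeriv ℝ (n - i) ψ (z 1)‖)) := by
          rw [Finset.mul_sum]
          refine Finset.sum_congr rfl fun i _ => by ring
      _ ≤ ∑ i ∈ Finset.range (n + 1), (n.choose i : ℝ) *
            (((2 : ℝ) ^ k * ((Finset.Iic (k, n)).sup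
              fun m => SchwartzMap.seminorm ℂ m.1 m.2) f) * B) := by
          refine Finset.sum_le_sum fun i hi => ?_
          have hi' : i ≤ n := Nat.lt_succ_iff.1 (Finset.mem_range.1 hi)
          refine mul_le_mul_of_nonneg_left (mul_le_mul ?_ ?_ (by positivity) (by positivity))
            (by positivity)
          · exact SchwartzMap.one_add_le_sup_seminorm_apply (𝕜 := ℂ) (m := (k, n)) le_rfl hi' f _
          · exact SchwartzMap.one_add_le_sup_seminorm_apply (𝕜 := ℂ) (m := (k, n)) le_rfl
              (Nat.sub_le n i) ψ _
      _ = (∑ i ∈ Finset.range (n + 1), (n.choose i : ℝ) * ((2 : ℝ) ^ k * B)) *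
            ((Finset.Iic (k, n)).sup (schwartzSeminormFamily ℂ ℝ ℂ)) f := by
          rw [Finset.sum_mul]
          refine Finset.sum_congr rfl fun i _ => ?_
          have : (schwartzSeminormFamily ℂ ℝ ℂ)
              = fun m : ℕ × ℕ => SchwartzMap.seminorm ℂ m.1 m.2 := rfl
          rw [this]
          ring

@[simp]
theorem tensor_apply (φ ψ : 𝓢(ℝ, ℂ)) (z : Phase) : tensor ψ φ z = φ (z 0) * ψ (z 1) := rfl

/-- Lebesgue integration over the phase space is the double integral `dx dp`. -/
theorem integral_phase (f : Phase → ℂ) (hf : Integrable f) :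
    ∫ z, f z = ∫ x : ℝ, ∫ y : ℝ, f (!₂[x, y]) := by
  have h1 := (PiLp.volume_preserving_toLp (Fin 2)).integral_comp
    (MeasurableEquiv.toLp 2 (Fin 2 → ℝ)).measurableEmbedding f
  have h2 := (volume_preserving_finTwoArrow ℝ).symm.integral_comp
    (MeasurableEquiv.measurableEmbedding _) (fun v : Fin 2 → ℝ => f (WithLp.toLp 2 v))
  have i1 : Integrable (fun v : Fin 2 → ℝ => f (WithLp.toLp 2 v)) :=
    ((PiLp.volume_preserving_toLp (Fin 2)).integrable_comp_emb
      (MeasurableEquiv.toLp 2 (Fin 2 → ℝ)).measurableEmbedding).2 hf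
  have i2 := ((volume_preserving_finTwoArrow ℝ).symm.integrable_comp_emb
    (MeasurableEquiv.measurableEmbedding _)).2 i1
  rw [← h1, ← h2]
  exact integral_prod _ i2

/-- The linear automorphism `(x, p) ↦ (-c p, d x)` of the phase space. -/
def rot (c d : ℝ) (hc : c ≠ 0) (hd : d ≠ 0) : Phase ≃L[ℝ] Phase :=
  LinearEquiv.toContinuousLinearEquiv
    { toFun := fun z => !₂[-(c * z 1), d * z 0]
      invFun := fun w => !₂[d⁻¹ * w 1, -(c⁻¹ * w 0)]
      map_add' := fun z w => by
        ext i; fin_cases i <;> simp <;> ring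
      map_smul' := fun a z => by
        ext i; fin_cases i <;> simp <;> ring
      left_inv := fun z => by
        ext i; fin_cases i <;> simp [hc, hd]
      right_inv := fun w => by
        ext i; fin_cases i <;> simp [hc, hd] }

theorem rot_apply (c d : ℝ) (hc : c ≠ 0) (hd : d ≠ 0) (z : Phase) :
    rot c d hc hd z = !₂[-(c * z 1), d * z 0] := rfl

/-- The dilation `Ω ↦ c Ω`, for `c ≠ 0`. -/
def dilation (c : ℝ) (hc : c ≠ 0) : Phase ≃L[ℝ] Phase :=
  ContinuousLinearEquiv.smulLeft (Units.mk0 c hc)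

theorem dilation_apply (c : ℝ) (hc : c ≠ 0) (z : Phase) : dilation c hc z = c • z := rfl

/-- The reflection `a(Ω) ↦ a(-Ω)` of Schwartz functions. -/
def reflect : 𝓢(Phase, ℂ) →L[ℂ] 𝓢(Phase, ℂ) :=
  SchwartzMap.compCLMOfContinuousLinearEquiv ℂ (ContinuousLinearEquiv.neg ℝ)

/-- The reflection `θ ↦ θ^∨`, `θ^∨(Ω) = θ(-Ω)`, of tempered distributions. -/
def reflectDist : 𝓢'(Phase, ℂ) →L[ℂ] 𝓢'(Phase, ℂ) :=
  PointwiseConvergenceCLM.precomp ℂ reflect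

/-! ### The symplectic Fourier transform -/

theorem inv_two_pi_mul_ne_zero {ħ : ℝ} (hħ : 0 < ħ) : (2 * Real.pi * ħ)⁻¹ ≠ 0 := by positivity

theorem neg_inv_two_pi_mul_ne_zero {ħ : ℝ} (hħ : 0 < ħ) : -(2 * Real.pi * ħ)⁻¹ ≠ 0 :=
  neg_ne_zero.2 (inv_two_pi_mul_ne_zero hħ)

/-- The symplectic Fourier transform
`(F_σ a)(x, p) = (2πħ)⁻¹ ∫ exp (-(i/ħ) (x' p - x p')) a(x', p') dx' dp'` of Schwartz functions,
see `sympFourier_apply`. -/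
def sympFourier {ħ : ℝ} (hħ : 0 < ħ) : 𝓢(Phase, ℂ) →L[ℂ] 𝓢(Phase, ℂ) :=
  (((2 * Real.pi * ħ)⁻¹ : ℝ) : ℂ) •
    (SchwartzMap.compCLMOfContinuousLinearEquiv ℂ
      (rot (-(2 * Real.pi * ħ)⁻¹) (-(2 * Real.pi * ħ)⁻¹) (neg_inv_two_pi_mul_ne_zero hħ)
        (neg_inv_two_pi_mul_ne_zero hħ)) ∘L
      FourierTransform.fourierCLM ℂ 𝓢(Phase, ℂ))

theorem sympFourier_apply {ħ : ℝ} (hħ : 0 < ħ) (a : 𝓢(Phase, ℂ)) (z : Phase) :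
    sympFourier hħ a z = (2 * Real.pi * ħ)⁻¹ *
      ∫ w : Phase, Complex.exp (-(Complex.I / ħ) * (w 0 * z 1 - z 0 * w 1)) * a w := by
  have h : sympFourier hħ a z = (((2 * Real.pi * ħ)⁻¹ : ℝ) : ℂ) •
      (𝓕 (a : Phase → ℂ)) (rot (-(2 * Real.pi * ħ)⁻¹) (-(2 * Real.pi * ħ)⁻¹)
        (neg_inv_two_pi_mul_ne_zero hħ) (neg_inv_two_pi_mul_ne_zero hħ) z) := rfl
  rw [h, Real.fourier_eq', smul_eq_mul]
  push_cast
  congr 1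
  refine integral_congr_ae (Eventually.of_forall fun w => ?_)
  have hπ : (Real.pi : ℂ) ≠ 0 := by exact_mod_cast Real.pi_ne_zero
  have hħ' : (ħ : ℂ) ≠ 0 := by exact_mod_cast hħ.ne'
  simp only [smul_eq_mul, rot_apply, PiLp.inner_apply, Fin.sum_univ_two]
  congr 2
  simp
  field_simp
  ring

/-- The symplectic Fourier transform of tempered distributions. Since the kernel of `F_σ` is
antisymmetric in its two arguments, the transpose of `F_σ` for the bilinear pairing `∫ a b` is
`b ↦ (F_σ b)^∨`; so this extends `F_σ` from functions, see `sympFourierDist_coe`. -/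
def sympFourierDist {ħ : ℝ} (hħ : 0 < ħ) : 𝓢'(Phase, ℂ) →L[ℂ] 𝓢'(Phase, ℂ) :=
  PointwiseConvergenceCLM.precomp ℂ (reflect ∘L sympFourier hħ)

theorem sympFourierDist_coe {ħ : ℝ} (hħ : 0 < ħ) (f : 𝓢(Phase, ℂ)) :
    sympFourierDist hħ (SchwartzMap.toTemperedDistributionCLM Phase ℂ volume f)
      = SchwartzMap.toTemperedDistributionCLM Phase ℂ volume (sympFourier hħ f) := by
  ext g
  have hl : sympFourierDist hħ (SchwartzMap.toTemperedDistributionCLM Phase ℂ volume f) g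
      = ∫ z, sympFourier hħ g (-z) * f z :=
    SchwartzMap.toTemperedDistributionCLM_apply_apply volume f (reflect (sympFourier hħ g))
  have hr : SchwartzMap.toTemperedDistributionCLM Phase ℂ volume (sympFourier hħ f) g
      = ∫ w, g w * sympFourier hħ f w :=
    SchwartzMap.toTemperedDistributionCLM_apply_apply volume (sympFourier hħ f) g
  rw [hl, hr]
  set E : Phase → Phase → ℂ := fun z w =>
    Complex.exp (Complex.I * ((ħ⁻¹ * (w 0 * z 1 - z 0 * w 1) : ℝ) : ℂ)) with hE
  have h1 : ∀ z, sympFourier hħ g (-z) * f z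
      = (2 * Real.pi * ħ)⁻¹ * ∫ w, E z w * (g w * f z) := by
    intro z
    rw [sympFourier_apply, mul_assoc, ← integral_mul_const]
    congr 1
    refine integral_congr_ae (Eventually.of_forall fun w => ?_)
    simp only [hE]
    rw [mul_assoc]
    congr 2
    simp
    ring
  have h2 : ∀ w, g w * sympFourier hħ f w
      = (2 * Real.pi * ħ)⁻¹ * ∫ z, E z w * (g w * f z) := by
    intro w
    rw [sympFourier_apply, mul_left_comm, ← integral_const_mul]
    congr 1
    refine integral_congr_ae (Eventually.of_forall fun z => ?_)
    simp only [hE]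
    rw [mul_left_comm]
    congr 2
    push_cast
    ring
  simp only [h1, h2, integral_const_mul]
  congr 1
  refine integral_integral_swap ?_
  have hi : Integrable (fun q : Phase × Phase => g q.2 * f q.1) (volume.prod volume) := by
    have h := (f.integrable (μ := volume)).mul_prod (g.integrable (μ := volume))
    refine h.congr (Eventually.of_forall fun q => mul_comm _ _)
  refine hi.bdd_mul (c := 1) ?_ ?_
  · apply Continuous.aestronglyMeasurable
    simp only [hE]
    fun_prop
  · refine Eventually.of_forall fun q => ?_
    simp only [hE]
    rw [mul_comm Complex.I, Complex.norm_exp_ofReal_mul_I]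

/-! ### Displacement operators and parity -/

/-- The displacement operator on Schwartz functions,
`(D(x₀, p₀) ψ)(x) = exp ((i/ħ) (p₀ x - p₀ x₀ / 2)) ψ(x - x₀)`, see `disp_apply`. -/
def disp (ħ : ℝ) (Ω : Phase) : 𝓢(ℝ, ℂ) →L[ℂ] 𝓢(ℝ, ℂ) :=
  SchwartzMap.smulLeftCLM ℂ
    (fun x : ℝ => Complex.exp (Complex.I * ((ħ⁻¹ * (Ω 1 * x - Ω 1 * Ω 0 / 2) : ℝ) : ℂ))) ∘L
    SchwartzMap.compSubConstCLM ℂ (Ω 0)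

theorem disp_apply (ħ : ℝ) (Ω : Phase) (ψ : 𝓢(ℝ, ℂ)) (x : ℝ) :
    disp ħ Ω ψ x =
      Complex.exp (Complex.I / ħ * (Ω 1 * x - Ω 1 * Ω 0 / 2)) * ψ (x - Ω 0) := by
  have hg : (fun x : ℝ => Complex.exp
      (Complex.I * ((ħ⁻¹ * (Ω 1 * x - Ω 1 * Ω 0 / 2) : ℝ) : ℂ))).HasTemperateGrowth := by
    have h : (fun x : ℝ => ħ⁻¹ * (Ω 1 * x - Ω 1 * Ω 0 / 2)).HasTemperateGrowth := by fun_prop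
    exact hasTemperateGrowth_cexp_I.comp h
  have h := SchwartzMap.smulLeftCLM_apply_apply hg (SchwartzMap.compSubConstCLM ℂ (Ω 0) ψ) x
  refine h.trans ?_
  rw [smul_eq_mul, SchwartzMap.compSubConstCLM_apply]
  congr 2
  push_cast
  ring

/-- `D(Ω)† = D(-Ω)`: this is the `L²` adjoint of `D(Ω)`, see `integral_conj_mul_disp`. -/
def dispAdj (ħ : ℝ) (Ω : Phase) : 𝓢(ℝ, ℂ) →L[ℂ] 𝓢(ℝ, ℂ) := disp ħ (-Ω)

theorem integral_conj_mul_disp (ħ : ℝ) (Ω : Phase) (φ ψ : 𝓢(ℝ, ℂ)) :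
    ∫ x, starRingEnd ℂ (φ x) * disp ħ Ω ψ x
      = ∫ x, starRingEnd ℂ (dispAdj ħ Ω φ x) * ψ x := by
  rw [← integral_add_right_eq_self _ (Ω 0)]
  refine integral_congr_ae (Eventually.of_forall fun x => ?_)
  simp only [dispAdj, disp_apply, map_mul, ← Complex.exp_conj]
  simp only [map_mul, map_sub, map_div₀, Complex.conj_I, Complex.conj_ofReal, map_ofNat, PiLp.neg_apply,
    sub_neg_eq_add, add_sub_cancel_right]
  rw [mul_left_comm, mul_assoc]
  congr 2
  push_cast
  simp
  ring

/-- The displacement operator on tempered distributions: the transpose of `D(-x₀, p₀)`, which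
is the transpose of `D(x₀, p₀)` for the bilinear pairing, see `integral_mul_disp`; equivalently
`⟨φ | D(Ω) T⟩ = ⟨D(Ω)† φ | T⟩` for the sesquilinear pairing. -/
def dispDist (ħ : ℝ) (Ω : Phase) : 𝓢'(ℝ, ℂ) →L[ℂ] 𝓢'(ℝ, ℂ) :=
  PointwiseConvergenceCLM.precomp ℂ (disp ħ !₂[-Ω 0, Ω 1])

theorem integral_mul_disp (ħ : ℝ) (Ω : Phase) (φ ψ : 𝓢(ℝ, ℂ)) :
    ∫ x, φ x * disp ħ Ω ψ x = ∫ x, disp ħ !₂[-Ω 0, Ω 1] φ x * ψ x := by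
  rw [← integral_add_right_eq_self _ (Ω 0)]
  refine integral_congr_ae (Eventually.of_forall fun x => ?_)
  simp only [disp_apply]
  rw [add_sub_cancel_right, mul_left_comm, mul_assoc]
  simp
  left
  congr 1
  ring

/-- The parity operator `(Π ψ)(x) = ψ(-x)`. -/
def parity : 𝓢(ℝ, ℂ) →L[ℂ] 𝓢(ℝ, ℂ) :=
  SchwartzMap.compCLMOfContinuousLinearEquiv ℂ (ContinuousLinearEquiv.neg ℝ)

theorem parity_apply (ψ : 𝓢(ℝ, ℂ)) (x : ℝ) : parity ψ x = ψ (-x) := rfl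

/-! ### Matrix elements of displacement and Grossmann-Royer operators -/

/-- The matrix elements of the displacement operators,
`dispForm hħ ψ φ Ω = ∫ φ(x) (D(Ω) ψ)(x) dx`, as a Schwartz function of `Ω`;
see `dispForm_apply`. -/
def dispForm {ħ : ℝ} (hħ : 0 < ħ) (ψ : 𝓢(ℝ, ℂ)) : 𝓢(ℝ, ℂ) →L[ℂ] 𝓢(Phase, ℂ) :=
  SchwartzMap.smulLeftCLM ℂ (chirp (-(2 * ħ)⁻¹)) ∘L
    SchwartzMap.compCLMOfContinuousLinearEquiv ℂ
      (rot (2 * Real.pi * ħ)⁻¹ 1 (inv_two_pi_mul_ne_zero hħ) one_ne_zero) ∘L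
    FourierTransform.fourierCLM ℂ 𝓢(Phase, ℂ) ∘L
    SchwartzMap.smulLeftCLM ℂ (chirp (2 * Real.pi)) ∘L
    tensor (𝓕 ψ)

theorem dispForm_apply {ħ : ℝ} (hħ : 0 < ħ) (ψ φ : 𝓢(ℝ, ℂ)) (Ω : Phase) :
    dispForm hħ ψ φ Ω = ∫ x, φ x * disp ħ Ω ψ x := by
  have hπ : (Real.pi : ℂ) ≠ 0 := by exact_mod_cast Real.pi_ne_zero
  have hħ' : (ħ : ℂ) ≠ 0 := by exact_mod_cast hħ.ne'
  set G : 𝓢(Phase, ℂ) := SchwartzMap.smulLeftCLM ℂ (chirp (2 * Real.pi)) (tensor (𝓕 ψ) φ) with hG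
  have hGa : ∀ z : Phase, G z = chirp (2 * Real.pi) z * (φ (z 0) * 𝓕 ψ (z 1)) := fun z =>
    SchwartzMap.smulLeftCLM_apply_apply (hasTemperateGrowth_chirp _) _ z
  have h1 : dispForm hħ ψ φ Ω = chirp (-(2 * ħ)⁻¹) Ω • (𝓕 (G : Phase → ℂ))
      (rot (2 * Real.pi * ħ)⁻¹ 1 (inv_two_pi_mul_ne_zero hħ) one_ne_zero Ω) :=
    SchwartzMap.smulLeftCLM_apply_apply (hasTemperateGrowth_chirp _) _ Ω
  have hinv : ∀ y : ℝ, ψ y = ∫ ξ : ℝ, Complex.exp (↑(2 * Real.pi * (ξ * y)) * Complex.I) *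
      𝓕 ψ ξ := by
    intro y
    have h : ψ y = (𝓕⁻ (𝓕 ψ) : 𝓢(ℝ, ℂ)) y := by rw [FourierTransform.fourierInv_fourier_eq]
    rw [h, SchwartzMap.fourierInv_coe, Real.fourierInv_eq']
    simp only [smul_eq_mul]
    refine integral_congr_ae (Eventually.of_forall fun ξ => ?_)
    simp [mul_comm]
  rw [h1, Real.fourier_eq, smul_eq_mul, integral_phase]
  · rw [← integral_const_mul]
    refine integral_congr_ae (Eventually.of_forall fun x => ?_)
    simp only
    rw [disp_apply, hinv, ← integral_const_mul, ← integral_const_mul, ← integral_const_mul]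
    refine integral_congr_ae (Eventually.of_forall fun ξ => ?_)
    simp only [hGa, rot_apply, chirp, Circle.smul_def, Real.fourierChar_apply, smul_eq_mul,
      PiLp.inner_apply, Fin.sum_univ_two]
    simp only [Matrix.cons_val_zero, Matrix.cons_val_one]
    rw [show ∀ a b c d e : ℂ, a * (b * (c * (d * e))) = d * ((a * b * c) * e) by
      intros; ring]
    rw [show ∀ a b c : ℂ, (φ x : ℂ) * (a * (b * c)) = φ x * ((a * b) * c) by intros; ring]
    rw [← Complex.exp_add, ← Complex.exp_add, ← Complex.exp_add]
    congr 3
    simp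
    field_simp
    ring
  · have := (Real.fourierIntegral_convergent_iff (μ := volume) (f := (G : Phase → ℂ))
      (rot (2 * Real.pi * ħ)⁻¹ 1 (inv_two_pi_mul_ne_zero hħ) one_ne_zero Ω)).2 G.integrable
    exact this

/-- The matrix elements of the Grossmann-Royer operators `D(Ω) Π D(Ω)†`,
`grForm hħ ψ φ Ω = ∫ φ(x) (D(Ω) Π D(Ω)† ψ)(x) dx`, as a Schwartz function of `Ω`;
see `grForm_apply`. -/
def grForm {ħ : ℝ} (hħ : 0 < ħ) (ψ : 𝓢(ℝ, ℂ)) : 𝓢(ℝ, ℂ) →L[ℂ] 𝓢(Phase, ℂ) :=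
  SchwartzMap.compCLMOfContinuousLinearEquiv ℂ (dilation 2 two_ne_zero) ∘L
    dispForm hħ (parity ψ)

theorem grForm_apply {ħ : ℝ} (hħ : 0 < ħ) (ψ φ : 𝓢(ℝ, ℂ)) (Ω : Phase) :
    grForm hħ ψ φ Ω = ∫ x, φ x * disp ħ Ω (parity (dispAdj ħ Ω ψ)) x := by
  have h : grForm hħ ψ φ Ω = dispForm hħ (parity ψ) φ ((2 : ℝ) • Ω) := rfl
  rw [h, dispForm_apply]
  refine integral_congr_ae (Eventually.of_forall fun x => ?_)
  simp only [dispAdj, disp_apply, parity_apply]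
  rw [← mul_assoc (Complex.exp _), ← Complex.exp_add]
  have e : -(x - ((2 : ℝ) • Ω) 0) = -(x - Ω 0) - (-Ω) 0 := by simp; ring
  rw [e]
  congr 3
  simp
  ring

/-! ### Operators as weak integrals over the phase space -/

/-- Continuous linear operators from `𝓢(ℝ)` to `𝓢'(ℝ)`. -/
abbrev Op : Type := 𝓢(ℝ, ℂ) →L[ℂ] 𝓢'(ℝ, ℂ)

theorem tensor_swap (φ ψ : 𝓢(ℝ, ℂ)) :
    tensor ψ φ = reflect (SchwartzMap.compCLMOfContinuousLinearEquiv ℂ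
      (rot 1 (-1) one_ne_zero (by norm_num)) (tensor φ ψ)) := by
  ext z
  have h : (reflect (SchwartzMap.compCLMOfContinuousLinearEquiv ℂ
      (rot 1 (-1) one_ne_zero (by norm_num)) (tensor φ ψ))) z
      = tensor φ ψ (rot 1 (-1) one_ne_zero (by norm_num) (-z)) := rfl
  rw [h]
  simp [rot_apply, mul_comm]

theorem tensor_add (φ ψ ψ' : 𝓢(ℝ, ℂ)) : tensor (ψ + ψ') φ = tensor ψ φ + tensor ψ' φ := by
  ext z; simp [mul_add]

theorem tensor_smul (φ ψ : 𝓢(ℝ, ℂ)) (c : ℂ) : tensor (c • ψ) φ = c • tensor ψ φ := by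
  ext z; simp [mul_left_comm]

theorem dispForm_add {ħ : ℝ} (hħ : 0 < ħ) (φ ψ ψ' : 𝓢(ℝ, ℂ)) :
    dispForm hħ (ψ + ψ') φ = dispForm hħ ψ φ + dispForm hħ ψ' φ := by
  simp only [dispForm, ContinuousLinearMap.comp_apply, FourierTransform.fourier_add, tensor_add,
    map_add]

theorem dispForm_smul {ħ : ℝ} (hħ : 0 < ħ) (φ ψ : 𝓢(ℝ, ℂ)) (c : ℂ) :
    dispForm hħ (c • ψ) φ = c • dispForm hħ ψ φ := by
  simp only [dispForm, ContinuousLinearMap.comp_apply, FourierTransform.fourier_smul,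
    tensor_smul, map_smul]

theorem continuous_dispForm {ħ : ℝ} (hħ : 0 < ħ) (φ : 𝓢(ℝ, ℂ)) :
    Continuous fun ψ : 𝓢(ℝ, ℂ) => dispForm hħ ψ φ := by
  simp only [dispForm, ContinuousLinearMap.comp_apply, tensor_swap φ]
  have h : Continuous fun ψ : 𝓢(ℝ, ℂ) => 𝓕 ψ :=
    (FourierTransform.fourierCLM ℂ 𝓢(ℝ, ℂ)).continuous
  fun_prop

/-- The operator `∫ T(Ω) D(Ω) dΩ` for a tempered distribution `T`, in the weak sense: its matrix
elements are obtained by applying `T` to those of `D(Ω)`. -/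
def integralDisp {ħ : ℝ} (hħ : 0 < ħ) (T : 𝓢'(Phase, ℂ)) : Op where
  toFun ψ := ContinuousLinearMap.toPointwiseConvergenceCLM ℂ (RingHom.id ℂ) _ _
    ((T : 𝓢(Phase, ℂ) →L[ℂ] ℂ) ∘L dispForm hħ ψ)
  map_add' ψ ψ' := by
    ext φ
    exact (congrArg T (dispForm_add hħ φ ψ ψ')).trans (map_add T _ _)
  map_smul' c ψ := by
    ext φ
    exact (congrArg T (dispForm_smul hħ φ ψ c)).trans (map_smul T _ _)
  cont := PointwiseConvergenceCLM.continuous_of_continuous_eval fun φ =>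
    T.continuous.comp (continuous_dispForm hħ φ)

theorem integralDisp_apply {ħ : ℝ} (hħ : 0 < ħ) (T : 𝓢'(Phase, ℂ)) (ψ φ : 𝓢(ℝ, ℂ)) :
    integralDisp hħ T ψ φ = T (dispForm hħ ψ φ) := rfl

/-- The operator `∫ T(Ω) D(Ω) Π D(Ω)† dΩ` for a tempered distribution `T`, in the weak sense: its
matrix elements are obtained by applying `T` to those of `D(Ω) Π D(Ω)†`. -/
def integralGR {ħ : ℝ} (hħ : 0 < ħ) (T : 𝓢'(Phase, ℂ)) : Op where
  toFun ψ := ContinuousLinearMap.toPointwiseConvergenceCLM ℂ (RingHom.id ℂ) _ _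
    ((T : 𝓢(Phase, ℂ) →L[ℂ] ℂ) ∘L grForm hħ ψ)
  map_add' ψ ψ' := by
    ext φ
    simp only [grForm, map_add]
    exact (congrArg (fun g => T (SchwartzMap.compCLMOfContinuousLinearEquiv ℂ
      (dilation 2 two_ne_zero) g)) (dispForm_add hħ φ (parity ψ) (parity ψ'))).trans
        (by rw [map_add, map_add]; rfl)
  map_smul' c ψ := by
    ext φ
    simp only [grForm, map_smul]
    exact (congrArg (fun g => T (SchwartzMap.compCLMOfContinuousLinearEquiv ℂ
      (dilation 2 two_ne_zero) g)) (dispForm_smul hħ φ (parity ψ) c)).trans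
        (by rw [map_smul, map_smul]; rfl)
  cont := PointwiseConvergenceCLM.continuous_of_continuous_eval fun φ =>
    T.continuous.comp ((SchwartzMap.compCLMOfContinuousLinearEquiv ℂ
      (dilation 2 two_ne_zero)).continuous.comp
        ((continuous_dispForm hħ φ).comp parity.continuous))

theorem integralGR_apply {ħ : ℝ} (hħ : 0 < ħ) (T : 𝓢'(Phase, ℂ)) (ψ φ : 𝓢(ℝ, ℂ)) :
    integralGR hħ T ψ φ = T (grForm hħ ψ φ) := rfl

/-- The displaced operator `D(Ω) A D(Ω)†`. -/
def displaced (ħ : ℝ) (Ω : Phase) (A : Op) : Op := dispDist ħ Ω ∘L A ∘L dispAdj ħ Ω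

/-- `χ(ε Ω)` as a Schwartz function of `Ω`, for `ε ≠ 0` (and `0` for `ε = 0`). -/
def dilate (ε : ℝ) (χ : 𝓢(Phase, ℂ)) : 𝓢(Phase, ℂ) :=
  if h : ε ≠ 0 then SchwartzMap.compCLMOfContinuousLinearEquiv ℂ (dilation ε h) χ else 0

/-- `I` is the integral `∫ a(Ω) g(Ω) dΩ` of a smooth function `g`, all of whose derivatives are
polynomially bounded, against a tempered distribution `a`. As `g` need not be a Schwartz function,
the integral is regularized: for every Schwartz function `χ` with `χ(0) = 1`, the numbers
`∫ a(Ω) χ(ε Ω) g(Ω) dΩ` tend to `I` as `ε → 0+`. -/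
def HasPhaseIntegral (a : 𝓢'(Phase, ℂ)) (g : Phase → ℂ) (I : ℂ) : Prop :=
  g.HasTemperateGrowth ∧ ∀ χ : 𝓢(Phase, ℂ), χ 0 = 1 →
    Tendsto (fun ε : ℝ => a (SchwartzMap.smulLeftCLM ℂ g (dilate ε χ))) (𝓝[>] 0) (𝓝 I)

/-- `B` is the weak integral `∫ a(Ω) A(Ω) dΩ` of a family of operators `A(Ω)` against a tempered
distribution `a`. -/
def IsPhaseIntegral (a : 𝓢'(Phase, ℂ)) (A : Phase → Op) (B : Op) : Prop :=
  ∀ ψ φ : 𝓢(ℝ, ℂ), HasPhaseIntegral a (fun Ω => A Ω ψ φ) (B ψ φ)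

/-! ### Convolution of tempered distributions -/

/-- A tempered distribution is slowly increasing if it is given by a smooth function that is,
with all its derivatives, polynomially bounded. -/
def IsSlowlyIncreasing (T : 𝓢'(Phase, ℂ)) : Prop :=
  ∃ (f : Phase → ℂ) (hf : f.HasTemperateGrowth), T = hf.toTemperedDistribution volume

open Classical in
/-- The product of two tempered distributions one of which is slowly increasing
(`0` if neither is). -/
def mulDist (S T : 𝓢'(Phase, ℂ)) : 𝓢'(Phase, ℂ) :=
  if h : IsSlowlyIncreasing S then TemperedDistribution.smulLeftCLM ℂ h.choose T
  else if h : IsSlowlyIncreasing T then TemperedDistribution.smulLeftCLM ℂ h.choose S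
  else 0

/-- Two tempered distributions are convolvable if the symplectic Fourier transform of one of them
is a slowly increasing function. -/
def Convolvable {ħ : ℝ} (hħ : 0 < ħ) (a b : 𝓢'(Phase, ℂ)) : Prop :=
  IsSlowlyIncreasing (sympFourierDist hħ a) ∨ IsSlowlyIncreasing (sympFourierDist hħ b)

/-- The convolution `a ∗ b = 2πħ F_σ[(F_σ a) (F_σ b)]` of convolvable tempered distributions. -/
def conv {ħ : ℝ} (hħ : 0 < ħ) (a b : 𝓢'(Phase, ℂ)) : 𝓢'(Phase, ℂ) :=
  ((2 * Real.pi * ħ : ℝ) : ℂ) •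
    sympFourierDist hħ (mulDist (sympFourierDist hħ a) (sympFourierDist hħ b))

/-! ### Quantizations and parity operators -/

/-- The Weyl quantization `Op_Weyl(a) = (πħ)⁻¹ ∫ a(Ω) D(Ω) Π D(Ω)† dΩ`. -/
def opWeyl {ħ : ℝ} (hħ : 0 < ħ) (a : 𝓢'(Phase, ℂ)) : Op :=
  (((Real.pi * ħ)⁻¹ : ℝ) : ℂ) • integralGR hħ a

/-- The quantization `Op_θ(a) = Op_Weyl(a ∗ θ^∨)` associated with the Cohen kernel `θ`. -/
def opCohen {ħ : ℝ} (hħ : 0 < ħ) (θ a : 𝓢'(Phase, ℂ)) : Op :=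
  opWeyl hħ (conv hħ a (reflectDist θ))

/-- The filter function `K_θ(Ω) = 2πħ (F_σ θ)(-Ω)` of the Cohen kernel `θ`. -/
def filterFun {ħ : ℝ} (hħ : 0 < ħ) (θ : 𝓢'(Phase, ℂ)) : 𝓢'(Phase, ℂ) :=
  ((2 * Real.pi * ħ : ℝ) : ℂ) • reflectDist (sympFourierDist hħ θ)

/-- The parity operator `Π_θ = (4πħ)⁻¹ ∫ K_θ(Ω) D(Ω) dΩ`. -/
def parityCohen {ħ : ℝ} (hħ : 0 < ħ) (θ : 𝓢'(Phase, ℂ)) : Op :=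
  (((4 * Real.pi * ħ)⁻¹ : ℝ) : ℂ) • integralDisp hħ (filterFun hħ θ)

end CohenQuant

end

/-! Write `S = θ^∨` and let `G = grForm hħ ψ φ` be the matrix element of the Grossmann-Royer
operators. The symplectic Fourier transform takes displacement matrix elements to `2 G^∨`
(`sympFourier_dispForm`), so moving `F_σ` from the kernel to the matrix elements gives `Π_θ = ∫ S(Ω)
D(Ω) Π D(Ω)† dΩ` (`parityCohen_eq_integralGR`). Since `δ` is neutral for the convolution, this
already yields (3).

Conjugating by `D(Ω)` translates phase space (`grForm_displaced`). Hence the matrix element of `D(Ω)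
Π_θ D(Ω)†` is `g(Ω) = S(G(· + Ω))`, and `∫ a g dΩ` is formally `(a ∗ S)(G)`, which is the matrix
element of `Op_θ(a)` up to the factor `(πħ)⁻¹`. What has to be proved is that the convolution,
defined through Fourier transforms, agrees with this regularized integral (`hasPhaseIntegral_conv`).

With `T = F_σ S` and `u = (F_σ G)^∨` one has `g(Ω) = T(e_Ω u)`, where `e_Ω` is a symplectic
character. Taylor estimates for `e_Ω` in the Schwartz seminorms show that `g` is smooth, with
derivatives of the same form and of polynomial growth (`hasTemperateGrowth_map_modul`).

If `T` is a slowly increasing function `m`, then `g` is up to reflection and a constant the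
transform of the Schwartz function `m u`; the cut-offs `χ(ε ·) g` converge to `g` in the Schwartz
topology, and this also gives (2).

If instead `F_σ a` is a slowly increasing function `n`, then `a(g F_σ η) = ∫ η(y) T(n(· - y) u) dy`
for Schwartz `η` (`map_smulLeftCLM_map_modul`). Taking `η = F_σ(χ(ε ·))`, which concentrates at `0`
with total mass `2πħ χ(0)`, the limit is `2πħ T(n u) = (a ∗ S)(G)`. -/

namespace CohenQuant

/-! ### Multiplication operators on Schwartz functions -/

section Multipliers

variable {E : Type*} [NormedAddCommGroup E] [NormedSpace ℝ E]

/-- A product `m u` is bounded in the Schwartz seminorms by the bounds of the derivatives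
of the multiplier `m`. -/
theorem seminorm_smulLeftCLM_le (k n : ℕ) {m : E → ℂ} (hm : m.HasTemperateGrowth) {A : ℝ}
    (hA : 0 ≤ A) (h : ∀ i ≤ n, ∀ z, ‖iteratedFDeriv ℝ i m z‖ ≤ A * (1 + ‖z‖) ^ 2) (u : 𝓢(E, ℂ)) :
    SchwartzMap.seminorm ℂ k n (SchwartzMap.smulLeftCLM ℂ m u) ≤
      A * (2 ^ n * 2 ^ (k + 2) *
        (Finset.Iic (k + 2, n)).sup (fun m => SchwartzMap.seminorm ℂ m.1 m.2) u) := by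
  -- By the Leibniz rule, the quadratic growth allowed for the multiplier costs two powers of the
  -- weight, and the binomial coefficients sum to `2 ^ n`.
  refine SchwartzMap.seminorm_le_bound ℂ k n _ (by positivity) fun z => ?_
  have e : (SchwartzMap.smulLeftCLM ℂ m u : E → ℂ) = fun z => m z * u z := by
    ext z; exact SchwartzMap.smulLeftCLM_apply_apply hm u z
  rw [e]
  have hmul := norm_iteratedFDeriv_mul_le (hm.1.of_le (by exact_mod_cast le_top) : ContDiff ℝ n m)
    (u.smooth n) z (n := n) le_rfl
  calc ‖z‖ ^ k * ‖iteratedFDeriv ℝ n (fun z => m z * u z) z‖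
      ≤ (1 + ‖z‖) ^ k * ∑ i ∈ Finset.range (n + 1), (n.choose i : ℝ) *
          ‖iteratedFDeriv ℝ i m z‖ * ‖iteratedFDeriv ℝ (n - i) u z‖ := by
        refine mul_le_mul (pow_le_pow_left₀ (norm_nonneg _) (by linarith) k) hmul
          (norm_nonneg _) (by positivity)
    _ ≤ (1 + ‖z‖) ^ k * ∑ i ∈ Finset.range (n + 1), (n.choose i : ℝ) *
          (A * (1 + ‖z‖) ^ 2) * ‖iteratedFDeriv ℝ (n - i) u z‖ := by
        gcongr with i hi
        exact h i (Nat.lt_succ_iff.1 (Finset.mem_range.1 hi)) z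
    _ = ∑ i ∈ Finset.range (n + 1), (n.choose i : ℝ) * (A *
          ((1 + ‖z‖) ^ (k + 2) * ‖iteratedFDeriv ℝ (n - i) u z‖)) := by
        rw [Finset.mul_sum]
        refine Finset.sum_congr rfl fun i _ => by ring
    _ ≤ ∑ i ∈ Finset.range (n + 1), (n.choose i : ℝ) * (A * (2 ^ (k + 2) *
          (Finset.Iic (k + 2, n)).sup (fun m => SchwartzMap.seminorm ℂ m.1 m.2) u)) := by
        gcongr ∑ i ∈ _, _ * (A * ?_) with i hi
        exact SchwartzMap.one_add_le_sup_seminorm_apply (𝕜 := ℂ) (m := (k + 2, n)) le_rfl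
          (Nat.sub_le n i) u z
    _ = _ := by
        rw [← Finset.sum_mul, ← Nat.cast_sum, Nat.sum_range_choose]
        push_cast
        ring

theorem norm_iteratedFDeriv_comp_clm_le {φ : ℝ → ℂ} (hφ : ContDiff ℝ ∞ φ) (l : E →L[ℝ] ℝ) (n : ℕ)
    (z : E) :
    ‖iteratedFDeriv ℝ n (fun z => φ (l z)) z‖ ≤ ‖iteratedDeriv n φ (l z)‖ * ‖l‖ ^ n := by
  have h := l.iteratedFDeriv_comp_right (f := φ) hφ z (i := n) (by exact_mod_cast le_top)
  have h2 : (fun z => φ (l z)) = φ ∘ l := rfl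
  rw [h2, h, ← norm_iteratedFDeriv_eq_norm_iteratedDeriv]
  refine (ContinuousMultilinearMap.norm_compContinuousLinearMap_le _ _).trans ?_
  simp

/-! ### Derivatives and Taylor remainders of `t ↦ exp (i t)`. -/

theorem contDiff_cexp_I : ContDiff ℝ ∞ fun t : ℝ => Complex.exp (Complex.I * t) :=
  hasTemperateGrowth_cexp_I.1

theorem hasDerivAt_cexp_I (t : ℝ) : HasDerivAt (fun t : ℝ => Complex.exp (Complex.I * t))
    (Complex.I * Complex.exp (Complex.I * t)) t := by
  have h1 : HasDerivAt (fun t : ℝ => Complex.I * (t : ℂ)) (Complex.I * 1) t :=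
    (Complex.ofRealCLM.hasDerivAt (x := t)).const_mul Complex.I
  convert h1.cexp using 1
  ring

theorem iteratedDeriv_cexp_I (n : ℕ) : iteratedDeriv n (fun t : ℝ => Complex.exp (Complex.I * t))
    = fun t : ℝ => Complex.I ^ n * Complex.exp (Complex.I * t) := by
  induction n with
  | zero => ext t; simp
  | succ n ih =>
    rw [iteratedDeriv_succ, ih]
    ext t
    rw [((hasDerivAt_cexp_I t).const_mul (Complex.I ^ n)).deriv]
    ring

theorem norm_iteratedDeriv_cexp_I (n : ℕ) (t : ℝ) :
    ‖iteratedDeriv n (fun t : ℝ => Complex.exp (Complex.I * t)) t‖ = 1 := by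
  rw [iteratedDeriv_cexp_I, norm_mul, norm_pow, Complex.norm_I, mul_comm Complex.I,
    Complex.norm_exp_ofReal_mul_I]
  simp

theorem iteratedDeriv_succ_cexp_I_sub_one (n : ℕ) :
    iteratedDeriv (n + 1) (fun t : ℝ => Complex.exp (Complex.I * t) - 1)
      = iteratedDeriv (n + 1) (fun t : ℝ => Complex.exp (Complex.I * t)) := by
  rw [iteratedDeriv_succ', iteratedDeriv_succ']
  congr 1
  ext t
  simp

theorem hasDerivAt_cexp_I_sub_one_sub (t : ℝ) :
    HasDerivAt (fun t : ℝ => Complex.exp (Complex.I * t) - 1 - Complex.I * t)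
      (Complex.I * (Complex.exp (Complex.I * t) - 1)) t := by
  have h1 : HasDerivAt (fun t : ℝ => Complex.I * (t : ℂ)) (Complex.I * 1) t :=
    (Complex.ofRealCLM.hasDerivAt (x := t)).const_mul Complex.I
  have h2 := ((hasDerivAt_cexp_I t).sub_const 1).sub h1
  rw [← mul_sub] at h2
  exact h2

/-- Differentiation lowers the order of the Taylor remainder by one, so the bounds for the
first-order remainder can be reused. -/
theorem iteratedDeriv_succ_cexp_I_sub_one_sub (n : ℕ) :
    iteratedDeriv (n + 1) (fun t : ℝ => Complex.exp (Complex.I * t) - 1 - Complex.I * t)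
      = fun t => Complex.I *
        iteratedDeriv n (fun t : ℝ => Complex.exp (Complex.I * t) - 1) t := by
  rw [iteratedDeriv_succ']
  rw [funext fun t => (hasDerivAt_cexp_I_sub_one_sub t).deriv]
  ext t
  rw [iteratedDeriv_const_mul_field]

theorem norm_cexp_I_sub_one_le (t : ℝ) : ‖Complex.exp (Complex.I * t) - 1‖ ≤ |t| := by
  simpa using Real.norm_exp_I_mul_ofReal_sub_one_le (x := t)

/-- Mean value inequality on the segment from `0` to `t`, where the derivative has norm at most
`|t|`. The sharper factor `1/2` is not needed. -/
theorem norm_cexp_I_sub_one_sub_le (t : ℝ) :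
    ‖Complex.exp (Complex.I * t) - 1 - Complex.I * t‖ ≤ |t| ^ 2 := by
  have h := (convex_segment (0 : ℝ) t).norm_image_sub_le_of_norm_hasDerivWithin_le (𝕜 := ℝ)
    (f := fun t : ℝ => Complex.exp (Complex.I * t) - 1 - Complex.I * t)
    (f' := fun t : ℝ => Complex.I * (Complex.exp (Complex.I * t) - 1)) (C := |t|)
    (fun s _ => (hasDerivAt_cexp_I_sub_one_sub s).hasDerivWithinAt) (fun s hs => ?_)
    (left_mem_segment ℝ 0 t)
    (right_mem_segment ℝ 0 t)
  · simpa [sq] using h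
  · rw [norm_mul, Complex.norm_I, one_mul]
    refine (norm_cexp_I_sub_one_le s).trans ?_
    rw [segment_eq_uIcc] at hs
    have := Set.abs_sub_left_of_mem_uIcc hs
    simpa using this

/-- The character `z ↦ exp (i l(z))`. -/
noncomputable def character (l : E →L[ℝ] ℝ) (z : E) : ℂ := Complex.exp (Complex.I * (l z : ℝ))

theorem hasTemperateGrowth_character (l : E →L[ℝ] ℝ) : (character l).HasTemperateGrowth :=
  hasTemperateGrowth_cexp_I.comp l.hasTemperateGrowth

theorem norm_character (l : E →L[ℝ] ℝ) (z : E) : ‖character l z‖ = 1 := by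
  rw [character, mul_comm, Complex.norm_exp_ofReal_mul_I]

theorem hasTemperateGrowth_ofReal_clm (l : E →L[ℝ] ℝ) :
    (fun z => (l z : ℂ)).HasTemperateGrowth :=
  (Complex.ofRealCLM ∘L l).hasTemperateGrowth

/-- This bound and the next two treat the character and its Taylor remainders of orders one and two
in `l`. They serve, respectively, for polynomial bounds, continuity and differentiability of
modulation in its parameter. -/
theorem seminorm_character_le (k n : ℕ) (l : E →L[ℝ] ℝ) (u : 𝓢(E, ℂ)) :
    SchwartzMap.seminorm ℂ k n (SchwartzMap.smulLeftCLM ℂ (character l) u) ≤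
      (1 + ‖l‖) ^ n * (2 ^ n * 2 ^ (k + 2) *
        (Finset.Iic (k + 2, n)).sup (fun m => SchwartzMap.seminorm ℂ m.1 m.2) u) := by
  refine seminorm_smulLeftCLM_le k n (hasTemperateGrowth_character l) (by positivity)
    (fun i hi z => ?_) u
  refine (norm_iteratedFDeriv_comp_clm_le contDiff_cexp_I l i z).trans ?_
  rw [norm_iteratedDeriv_cexp_I, one_mul]
  calc ‖l‖ ^ i ≤ (1 + ‖l‖) ^ i := by gcongr; linarith
    _ ≤ (1 + ‖l‖) ^ n := pow_le_pow_right₀ (by linarith [norm_nonneg l]) hi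
    _ ≤ (1 + ‖l‖) ^ n * (1 + ‖z‖) ^ 2 :=
      le_mul_of_one_le_right (by positivity) (one_le_pow₀ (by linarith [norm_nonneg z]))

theorem seminorm_character_sub_le (k n : ℕ) (l : E →L[ℝ] ℝ) (u : 𝓢(E, ℂ)) :
    SchwartzMap.seminorm ℂ k n (SchwartzMap.smulLeftCLM ℂ (character l) u - u) ≤
      ‖l‖ * (1 + ‖l‖) ^ n * (2 ^ n * 2 ^ (k + 2) *
        (Finset.Iic (k + 2, n)).sup (fun m => SchwartzMap.seminorm ℂ m.1 m.2) u) := by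
  have hm : (fun z => character l z - 1).HasTemperateGrowth :=
    (hasTemperateGrowth_character l).sub (.const 1)
  have e : SchwartzMap.smulLeftCLM ℂ (character l) u - u
      = SchwartzMap.smulLeftCLM ℂ (fun z => character l z - 1) u := by
    ext z
    simp only [sub_apply, SchwartzMap.smulLeftCLM_apply_apply hm,
      SchwartzMap.smulLeftCLM_apply_apply (hasTemperateGrowth_character l), smul_eq_mul]
    ring
  have h1 : 1 ≤ 1 + ‖l‖ := by linarith [norm_nonneg l]
  have hz1 : ∀ z : E, 1 ≤ 1 + ‖z‖ := fun z => by linarith [norm_nonneg z]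
  rw [e]
  refine seminorm_smulLeftCLM_le k n hm (by positivity) (fun i hi z => ?_) u
  refine (norm_iteratedFDeriv_comp_clm_le (contDiff_cexp_I.sub contDiff_const) l i z).trans ?_
  rcases i with _ | i
  · rw [iteratedDeriv_zero, pow_zero, mul_one]
    calc _ ≤ |l z| := norm_cexp_I_sub_one_le (l z)
      _ ≤ ‖l‖ * 1 * (‖z‖ * 1) := by simpa using l.le_opNorm z
      _ ≤ ‖l‖ * (1 + ‖l‖) ^ n * ((1 + ‖z‖) * (1 + ‖z‖)) := by
        have := one_le_pow₀ h1 (n := n)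
        have := hz1 z
        gcongr
        linarith
      _ = _ := by ring
  · rw [iteratedDeriv_succ_cexp_I_sub_one, norm_iteratedDeriv_cexp_I, one_mul]
    calc ‖l‖ ^ (i + 1) = ‖l‖ * ‖l‖ ^ i := pow_succ' _ _
      _ ≤ ‖l‖ * (1 + ‖l‖) ^ i := by gcongr; linarith
      _ ≤ ‖l‖ * (1 + ‖l‖) ^ n := by gcongr; all_goals omega
      _ ≤ ‖l‖ * (1 + ‖l‖) ^ n * (1 + ‖z‖) ^ 2 :=
        le_mul_of_one_le_right (by positivity) (one_le_pow₀ (hz1 z))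

theorem seminorm_character_sub_sub_le (k n : ℕ) (l : E →L[ℝ] ℝ) (u : 𝓢(E, ℂ)) :
    SchwartzMap.seminorm ℂ k n (SchwartzMap.smulLeftCLM ℂ (character l) u - u -
        SchwartzMap.smulLeftCLM ℂ (fun z => Complex.I * (l z : ℂ)) u) ≤
      ‖l‖ ^ 2 * (1 + ‖l‖) ^ n * (2 ^ n * 2 ^ (k + 2) *
        (Finset.Iic (k + 2, n)).sup (fun m => SchwartzMap.seminorm ℂ m.1 m.2) u) := by
  have hI : (fun z => Complex.I * (l z : ℂ)).HasTemperateGrowth :=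
    (Function.HasTemperateGrowth.const Complex.I).mul (hasTemperateGrowth_ofReal_clm l)
  have hm : (fun z => character l z - 1 - Complex.I * (l z : ℂ)).HasTemperateGrowth :=
    ((hasTemperateGrowth_character l).sub (.const 1)).sub hI
  have e : SchwartzMap.smulLeftCLM ℂ (character l) u - u -
        SchwartzMap.smulLeftCLM ℂ (fun z => Complex.I * (l z : ℂ)) u
      = SchwartzMap.smulLeftCLM ℂ (fun z => character l z - 1 - Complex.I * (l z : ℂ)) u := by
    ext z
    simp only [sub_apply, SchwartzMap.smulLeftCLM_apply_apply hm,
      SchwartzMap.smulLeftCLM_apply_apply hI,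
      SchwartzMap.smulLeftCLM_apply_apply (hasTemperateGrowth_character l), smul_eq_mul]
    ring
  have h1 : 1 ≤ 1 + ‖l‖ := by linarith [norm_nonneg l]
  have hz1 : ∀ z : E, 1 ≤ 1 + ‖z‖ := fun z => by linarith [norm_nonneg z]
  have hn := one_le_pow₀ h1 (n := n)
  rw [e]
  refine seminorm_smulLeftCLM_le k n hm (by positivity) (fun i hi z => ?_) u
  refine (norm_iteratedFDeriv_comp_clm_le
    (φ := fun t => Complex.exp (Complex.I * t) - 1 - Complex.I * t)
    ((contDiff_cexp_I.sub contDiff_const).sub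
      (contDiff_const.mul Complex.ofRealCLM.contDiff)) l i z).trans ?_
  have hl : |l z| ≤ ‖l‖ * ‖z‖ := l.le_opNorm z
  -- Both factors `‖l‖` come from the size of the remainder at order 0, one from it and one from the
  -- chain rule at order 1, and both from the chain rule at higher orders.
  rcases i with _ | _ | i
  · rw [iteratedDeriv_zero, pow_zero, mul_one]
    calc _ ≤ |l z| ^ 2 := norm_cexp_I_sub_one_sub_le (l z)
      _ ≤ (‖l‖ * ‖z‖) ^ 2 := by gcongr
      _ = ‖l‖ ^ 2 * 1 * ‖z‖ ^ 2 := by ring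
      _ ≤ ‖l‖ ^ 2 * (1 + ‖l‖) ^ n * (1 + ‖z‖) ^ 2 := by gcongr; linarith
  · rw [iteratedDeriv_succ_cexp_I_sub_one_sub, iteratedDeriv_zero, norm_mul, Complex.norm_I,
      one_mul, zero_add, pow_one]
    calc _ ≤ |l z| * ‖l‖ := by gcongr; exact norm_cexp_I_sub_one_le (l z)
      _ ≤ (‖l‖ * ‖z‖) * ‖l‖ := by gcongr
      _ = ‖l‖ ^ 2 * 1 * (‖z‖ * 1) := by ring
      _ ≤ ‖l‖ ^ 2 * (1 + ‖l‖) ^ n * ((1 + ‖z‖) * (1 + ‖z‖)) := by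
        have := hz1 z
        gcongr
        linarith
      _ = _ := by ring
  · rw [iteratedDeriv_succ_cexp_I_sub_one_sub, norm_mul, Complex.norm_I, one_mul,
      iteratedDeriv_succ_cexp_I_sub_one, norm_iteratedDeriv_cexp_I, one_mul]
    calc ‖l‖ ^ (i + 1 + 1) = ‖l‖ ^ 2 * ‖l‖ ^ i := by ring
      _ ≤ ‖l‖ ^ 2 * (1 + ‖l‖) ^ i := by gcongr; linarith
      _ ≤ ‖l‖ ^ 2 * (1 + ‖l‖) ^ n := by gcongr; all_goals omega
      _ ≤ ‖l‖ ^ 2 * (1 + ‖l‖) ^ n * (1 + ‖z‖) ^ 2 :=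
        le_mul_of_one_le_right (by positivity) (one_le_pow₀ (hz1 z))

end Multipliers

/-! ### Cut-off functions -/

theorem dilate_apply {ε : ℝ} (hε : ε ≠ 0) (χ : 𝓢(Phase, ℂ)) (z : Phase) :
    dilate ε χ z = χ (ε • z) := by
  rw [dilate, dif_pos hε]
  rfl

/-- The constant is independent of `u`, so the estimate gives both convergence of cut-offs and
bounds uniform over families. -/
theorem exists_seminorm_dilate_sub_le (χ : 𝓢(Phase, ℂ)) (hχ : χ 0 = 1) (k n : ℕ) :
    ∃ C : ℝ, 0 ≤ C ∧ ∀ ε : ℝ, 0 < ε → ε ≤ 1 → ∀ u : 𝓢(Phase, ℂ),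
      SchwartzMap.seminorm ℂ k n (SchwartzMap.smulLeftCLM ℂ (dilate ε χ) u - u) ≤
        ε * (C * (Finset.Iic (k + 2, n)).sup (fun m => SchwartzMap.seminorm ℂ m.1 m.2) u) := by
  -- Order `n + 1` rather than `n`: the mean value inequality below uses the first derivative of `χ`
  -- even when `n = 0`.
  set B : ℝ := (Finset.Iic (0, n + 1)).sup (fun m => SchwartzMap.seminorm ℂ m.1 m.2) χ with hB
  have hB0 : 0 ≤ B := apply_nonneg _ _
  have hχB : ∀ i ≤ n + 1, ∀ z, ‖iteratedFDeriv ℝ i χ z‖ ≤ B := by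
    intro i hi z
    simpa using SchwartzMap.one_add_le_sup_seminorm_apply (𝕜 := ℂ) (m := (0, n + 1)) le_rfl hi χ z
  refine ⟨B * (2 ^ n * 2 ^ (k + 2)), by positivity, fun ε h0 h1 u => ?_⟩
  have hd : (dilate ε χ : Phase → ℂ) = fun z => χ (ε • z) := by
    ext z; exact dilate_apply h0.ne' χ z
  have hm : (fun z => dilate ε χ z - 1).HasTemperateGrowth :=
    (dilate ε χ).hasTemperateGrowth.sub (.const 1)
  have e : SchwartzMap.smulLeftCLM ℂ (dilate ε χ) u - u
      = SchwartzMap.smulLeftCLM ℂ (fun z => dilate ε χ z - 1) u := by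
    ext z
    simp only [sub_apply, SchwartzMap.smulLeftCLM_apply_apply hm,
      SchwartzMap.smulLeftCLM_apply_apply (dilate ε χ).hasTemperateGrowth, smul_eq_mul]
    ring
  rw [e]
  refine (seminorm_smulLeftCLM_le k n hm (A := ε * B) (by positivity) (fun i hi z => ?_) u).trans
    (le_of_eq (by ring))
  have hz1 : 1 ≤ 1 + ‖z‖ := by linarith [norm_nonneg z]
  rcases i with _ | i
  · rw [norm_iteratedFDeriv_zero, hd]
    have hmv := (convex_univ (𝕜 := ℝ) (E := Phase)).norm_image_sub_le_of_norm_fderiv_le (𝕜 := ℝ)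
      (f := χ) (C := B) (fun x _ => χ.differentiableAt) (fun x _ => by
        rw [← norm_iteratedFDeriv_one]
        exact hχB 1 (by omega) x) (Set.mem_univ 0) (Set.mem_univ (ε • z))
    rw [hχ, sub_zero, norm_smul, Real.norm_of_nonneg h0.le] at hmv
    calc _ ≤ B * (ε * ‖z‖) := hmv
      _ = ε * B * (‖z‖ * 1) := by ring
      _ ≤ ε * B * ((1 + ‖z‖) * (1 + ‖z‖)) := by gcongr; linarith
      _ = _ := by ring
  · have hs : iteratedFDeriv ℝ (i + 1) (fun z => dilate ε χ z - 1) z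
        = iteratedFDeriv ℝ (i + 1) (dilate ε χ) z := by
      have h2 : (fun z => dilate ε χ z - 1) = (dilate ε χ : Phase → ℂ) - fun _ => 1 := rfl
      rw [h2, iteratedFDeriv_sub_apply ((dilate ε χ).smooth _).contDiffAt contDiffAt_const,
        iteratedFDeriv_const_of_ne (by omega)]
      simp
    rw [hs, hd, congrFun (iteratedFDeriv_comp_const_smul ε (χ.smooth (i + 1 : ℕ))) z]
    -- Each derivative of `χ(ε ·)` produces a factor `ε`; one of them is kept, the others are at
    -- most `1`.
    simp only [norm_smul, norm_pow, Real.norm_of_nonneg h0.le]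
    calc ε ^ (i + 1) * ‖iteratedFDeriv ℝ (i + 1) χ (ε • z)‖ ≤ ε * B := by
          have : ε ^ (i + 1) ≤ ε := pow_le_of_le_one h0.le h1 (by omega)
          gcongr
          exact hχB _ (by omega) _
      _ ≤ ε * B * (1 + ‖z‖) ^ 2 :=
        le_mul_of_one_le_right (by positivity) (one_le_pow₀ hz1)

theorem tendsto_smulLeftCLM_dilate (χ : 𝓢(Phase, ℂ)) (hχ : χ 0 = 1) (u : 𝓢(Phase, ℂ)) :
    Tendsto (fun ε : ℝ => SchwartzMap.smulLeftCLM ℂ (dilate ε χ) u) (𝓝[>] 0) (𝓝 u) := by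
  rw [(schwartz_withSeminorms ℂ Phase ℂ).tendsto_nhds]
  rintro ⟨k, n⟩ r hr
  obtain ⟨C, hC, h⟩ := exists_seminorm_dilate_sub_le χ hχ k n
  set q : ℝ := C * (Finset.Iic (k + 2, n)).sup (fun m => SchwartzMap.seminorm ℂ m.1 m.2) u
  have hq : Tendsto (fun ε : ℝ => ε * q) (𝓝[>] 0) (𝓝 0) := by
    have : Tendsto (fun ε : ℝ => ε * q) (𝓝 0) (𝓝 (0 * q)) := tendsto_id.mul_const q
    rw [zero_mul] at this
    exact this.mono_left nhdsWithin_le_nhds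
  filter_upwards [hq.eventually (gt_mem_nhds hr), Ioc_mem_nhdsGT one_pos] with ε h1 h2
  exact (h ε h2.1 h2.2 u).trans_lt h1

end CohenQuant

namespace CohenQuant

/-! ### Integrals of families of Schwartz functions -/

section SchwartzIntegral

open scoped BoundedContinuousFunction

variable {E : Type*} [NormedAddCommGroup E] [NormedSpace ℝ E]

/-- The space of bounded continuous functions with values in a normed space. -/
abbrev BddFun (E V : Type*) [TopologicalSpace E] [NormedAddCommGroup V] : Type _ := E →ᵇ V

/-- The weighted derivative `x ↦ ‖x‖ ^ k • D^n f(x)` as a bounded continuous function. -/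
noncomputable def weightedDeriv (k n : ℕ) :
    𝓢(E, ℂ) →L[ℂ] BddFun E (E [×n]→L[ℝ] ℂ) := by
  refine SchwartzMap.mkCLMtoNormedSpace (fun f =>
    BoundedContinuousFunction.ofNormedAddCommGroup (fun x => ‖x‖ ^ k • iteratedFDeriv ℝ n f x)
      ?_ (SchwartzMap.seminorm ℂ k n f) ?_) ?_ ?_ ⟨{(k, n)}, 1, zero_le_one, ?_⟩
  · have := (f.smooth ⊤).continuous_iteratedFDeriv (m := n) (by exact_mod_cast le_top)
    fun_prop
  · intro x
    rw [norm_smul, norm_pow, norm_norm]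
    exact SchwartzMap.le_seminorm ℂ k n f x
  · intro f g
    ext1 x
    have : iteratedFDeriv ℝ n (f + g) x = iteratedFDeriv ℝ n f x + iteratedFDeriv ℝ n g x :=
      iteratedFDeriv_add_apply (f.smooth n).contDiffAt (g.smooth n).contDiffAt
    exact (congrArg (‖x‖ ^ k • ·) this).trans (smul_add _ _ _)
  · intro a f
    ext1 x
    have : iteratedFDeriv ℝ n (a • f) x = a • iteratedFDeriv ℝ n f x :=
      iteratedFDeriv_const_smul_apply (f.smooth n).contDiffAt
    exact (congrArg (‖x‖ ^ k • ·) this).trans (smul_comm _ _ _)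
  · intro f
    rw [one_mul, Finset.sup_singleton]
    refine (BoundedContinuousFunction.norm_le (apply_nonneg _ _)).2 fun x => ?_
    rw [BoundedContinuousFunction.coe_ofNormedAddCommGroup, norm_smul, norm_pow, norm_norm]
    exact SchwartzMap.le_seminorm ℂ k n f x

theorem weightedDeriv_apply (k n : ℕ) (f : 𝓢(E, ℂ)) (x : E) :
    weightedDeriv k n f x = ‖x‖ ^ k • iteratedFDeriv ℝ n f x := rfl

theorem norm_weightedDeriv (k n : ℕ) (f : 𝓢(E, ℂ)) :
    ‖weightedDeriv k n f‖ = SchwartzMap.seminorm ℂ k n f := by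
  apply le_antisymm
  · refine (BoundedContinuousFunction.norm_le (apply_nonneg _ _)).2 fun x => ?_
    rw [weightedDeriv_apply, norm_smul, norm_pow, norm_norm]
    exact SchwartzMap.le_seminorm ℂ k n f x
  · refine SchwartzMap.seminorm_le_bound ℂ k n f (norm_nonneg _) fun x => ?_
    have := (weightedDeriv k n f).norm_coe_le_norm x
    rwa [weightedDeriv_apply, norm_smul, norm_pow, norm_norm] at this

/-- Every tempered distribution factors through finitely many weighted derivatives. -/
theorem exists_eq_weightedDeriv (T : 𝓢(E, ℂ) →L[ℂ] ℂ) :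
    ∃ (s : Finset (ℕ × ℕ))
      (A : (∀ i : s, BddFun E (E [×i.1.2]→L[ℝ] ℂ)) →L[ℂ] ℂ),
      ∀ f, T f = A fun i => weightedDeriv i.1.1 i.1.2 f := by
  classical
  obtain ⟨s₀, C, -, hC⟩ := Seminorm.bound_of_continuous (schwartz_withSeminorms ℂ E ℂ)
    ((normSeminorm ℂ ℂ).comp (T : 𝓢(E, ℂ) →ₗ[ℂ] ℂ)) (by
      exact continuous_norm.comp T.continuous)
  -- The index `(0, 0)` is added so that `J` below is injective: that component is `f` itself.
  set s : Finset (ℕ × ℕ) := insert (0, 0) s₀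
  let J : 𝓢(E, ℂ) →L[ℂ]
      (∀ i : s, BddFun E (E [×i.1.2]→L[ℝ] ℂ)) :=
    ContinuousLinearMap.pi fun i => weightedDeriv i.1.1 i.1.2
  have hJ : ∀ f, ‖T f‖ ≤ C * ‖J f‖ := by
    intro f
    refine (hC f).trans ?_
    rw [smul_apply, NNReal.smul_def, smul_eq_mul]
    refine mul_le_mul_of_nonneg_left (Seminorm.finset_sup_apply_le (norm_nonneg _) fun i hi => ?_)
      C.2
    rw [SchwartzMap.schwartzSeminormFamily_apply, ← norm_weightedDeriv]
    exact norm_le_pi_norm (J f) ⟨i, Finset.mem_insert_of_mem hi⟩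
  have hinj : Function.Injective J.toLinearMap := by
    refine (injective_iff_map_eq_zero _).2 fun f hf => ?_
    have h0 : weightedDeriv 0 0 f = 0 := congrFun hf ⟨(0, 0), Finset.mem_insert_self _ _⟩
    ext x
    have := congrArg (fun g => ‖g x‖) h0
    simpa [weightedDeriv_apply] using this
  let e := LinearEquiv.ofInjective J.toLinearMap hinj
  have he : ∀ f, (e f : ∀ i : s, BddFun E (E [×i.1.2]→L[ℝ] ℂ))
      = J f := fun f => rfl
  let A₀ : (LinearMap.range J.toLinearMap) →L[ℂ] ℂ :=
    LinearMap.mkContinuous (T.toLinearMap ∘ₗ (e.symm : _ →ₗ[ℂ] 𝓢(E, ℂ))) C fun y => by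
      have := hJ (e.symm y)
      rw [← he, e.apply_symm_apply] at this
      exact this
  -- Hahn-Banach extends the functional from the range of `J` to the whole product of Banach spaces.
  obtain ⟨A, hA, -⟩ := exists_extension_norm_eq _ A₀
  refine ⟨s, A, fun f => ?_⟩
  have := hA (e f)
  rw [he] at this
  refine Eq.trans ?_ this.symm
  change T f = T (e.symm (e f))
  rw [e.symm_apply_apply]

variable {W : Type*} [TopologicalSpace W] [SecondCountableTopology W] [MeasurableSpace W]
  [OpensMeasurableSpace W] {μ : Measure W}

theorem integrable_weightedDeriv {f : W → 𝓢(E, ℂ)} (hf : Continuous f) (k n : ℕ)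
    (hb : ∃ b : W → ℝ, Integrable b μ ∧ ∀ w, SchwartzMap.seminorm ℂ k n (f w) ≤ b w) :
    Integrable (fun w => weightedDeriv k n (f w)) μ := by
  obtain ⟨b, hb, h⟩ := hb
  refine hb.mono' ((weightedDeriv k n).continuous.comp hf).aestronglyMeasurable
    (Eventually.of_forall fun w => ?_)
  rw [norm_weightedDeriv]
  exact h w

theorem fderiv_integral_apply {V : Type*} [NormedAddCommGroup V] [NormedSpace ℝ V] {F : W → E → V}
    (hd : ∀ w, Differentiable ℝ (F w)) (hi : ∀ x, Integrable (fun w => F w x) μ) {x : E}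
    (hc : Continuous fun w => fderiv ℝ (F w) x) {b : W → ℝ} (hb : Integrable b μ)
    (h : ∀ w x, ‖fderiv ℝ (F w) x‖ ≤ b w) (v : E) :
    Integrable (fun w => fderiv ℝ (F w) x v) μ ∧
      fderiv ℝ (fun x => ∫ w, F w x ∂μ) x v = ∫ w, fderiv ℝ (F w) x v ∂μ := by
  have hF : Integrable (fun w => fderiv ℝ (F w) x) μ :=
    hb.mono' hc.aestronglyMeasurable (Eventually.of_forall fun w => h w x)
  refine ⟨hF.apply_continuousLinearMap v, ?_⟩
  rw [(hasFDerivAt_integral_of_dominated_of_fderiv_le (𝕜 := ℝ) (bound := b) Filter.univ_mem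
    (Eventually.of_forall fun x => (hi x).aestronglyMeasurable) (hi x) hF.aestronglyMeasurable
    (Eventually.of_forall fun w x _ => h w x) hb
    (Eventually.of_forall fun w x _ => (hd w).differentiableAt.hasFDerivAt)).fderiv,
    ContinuousLinearMap.integral_apply hF]

/-- Induction on `n` by differentiation under the integral sign: the seminorm `(0, n + 1)` bounds
the next derivative uniformly in `x`, and its integrable majorant dominates. -/
theorem iteratedFDeriv_integral {f : W → 𝓢(E, ℂ)} (hf : Continuous f)
    (hb : ∀ k n, ∃ b : W → ℝ, Integrable b μ ∧ ∀ w, SchwartzMap.seminorm ℂ k n (f w) ≤ b w)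
    (n : ℕ) :
    iteratedFDeriv ℝ n (fun x => ∫ w, f w x ∂μ) = fun x => ∫ w, iteratedFDeriv ℝ n (f w) x ∂μ := by
  have hcont : ∀ n x, Continuous fun w => iteratedFDeriv ℝ n (f w) x := by
    intro n x
    have h := (BoundedContinuousFunction.evalCLM ℂ x).continuous.comp
      ((weightedDeriv 0 n).continuous.comp hf)
    refine h.congr fun w => ?_
    simp [weightedDeriv_apply]
  have hint : ∀ n x, Integrable (fun w => iteratedFDeriv ℝ n (f w) x) μ := by
    intro n x
    obtain ⟨b, hb, h⟩ := hb 0 n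
    exact hb.mono' (hcont n x).aestronglyMeasurable (Eventually.of_forall fun w =>
      (SchwartzMap.norm_iteratedFDeriv_le_seminorm ℂ _ n x).trans (h w))
  induction n with
  | zero =>
    ext x m
    rw [iteratedFDeriv_zero_apply,
      ← ContinuousMultilinearMap.apply_apply (𝕜 := ℝ) (m := m),
      ← ContinuousLinearMap.integral_comp_comm _ (hint 0 x)]
    simp
  | succ n ih =>
    have hd : ∀ w, ContDiff ℝ 1 (iteratedFDeriv ℝ n (f w)) := fun w =>
      ((f w).smooth ⊤).iteratedFDeriv_right (by exact_mod_cast le_top)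
    obtain ⟨b, hb, h⟩ := hb 0 (n + 1)
    rw [iteratedFDeriv_succ_eq_comp_left, ih]
    ext x m
    have hcurry : ∀ w, fderiv ℝ (iteratedFDeriv ℝ n (f w)) x =
        continuousMultilinearCurryLeftEquiv ℝ (fun _ : Fin (n + 1) => E) ℂ
          (iteratedFDeriv ℝ (n + 1) (f w) x) := by
      intro w
      rw [iteratedFDeriv_succ_eq_comp_left]
      simp
    obtain ⟨h1, h2⟩ := fderiv_integral_apply (μ := μ) (F := fun w => iteratedFDeriv ℝ n (f w))
      (fun w => (hd w).differentiable one_ne_zero) (fun x => hint n x) (x := x) (by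
        simp only [hcurry]
        exact (LinearIsometryEquiv.continuous _).comp (hcont (n + 1) x)) hb (fun w x => by
        rw [norm_fderiv_iteratedFDeriv]
        exact (SchwartzMap.norm_iteratedFDeriv_le_seminorm ℂ _ (n + 1) x).trans (h w)) (m 0)
    simp only [Function.comp_apply]
    rw [continuousMultilinearCurryLeftEquiv_symm_apply, h2,
      ContinuousMultilinearMap.integral_apply h1,
      ContinuousMultilinearMap.integral_apply (hint (n + 1) x)]
    simp only [iteratedFDeriv_succ_apply_left]

/-- Tempered distributions commute with absolutely convergent integrals of Schwartz functions. -/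
theorem map_schwartz_integral (T : 𝓢(E, ℂ) →L[ℂ] ℂ) {f : W → 𝓢(E, ℂ)} (hf : Continuous f)
    (hb : ∀ k n, ∃ b : W → ℝ, Integrable b μ ∧ ∀ w, SchwartzMap.seminorm ℂ k n (f w) ≤ b w)
    {K : 𝓢(E, ℂ)} (hK : ∀ x, K x = ∫ w, f w x ∂μ) : T K = ∫ w, T (f w) ∂μ := by
  obtain ⟨s, A, hA⟩ := exists_eq_weightedDeriv T
  have hi : ∀ i : s, Integrable (fun w => weightedDeriv i.1.1 i.1.2 (f w)) μ := fun i =>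
    integrable_weightedDeriv hf _ _ (hb _ _)
  simp only [hA]
  -- After factoring `T` through Banach spaces, a Bochner integral is available and commutes with
  -- `A`; it remains to identify its components with the weighted derivatives of `K`.
  rw [ContinuousLinearMap.integral_comp_comm A (Integrable.of_eval hi)]
  congr 1
  ext1 i
  rw [eval_integral hi]
  ext1 x
  have hx : (∫ w, weightedDeriv i.1.1 i.1.2 (f w) ∂μ) x
      = ∫ w, weightedDeriv i.1.1 i.1.2 (f w) x ∂μ :=
    ((BoundedContinuousFunction.evalCLM ℝ x).integral_comp_comm (hi i)).symm
  have hK' : (K : E → ℂ) = fun x => ∫ w, f w x ∂μ := funext hK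
  rw [hx, weightedDeriv_apply, hK', iteratedFDeriv_integral hf hb]
  simp only [weightedDeriv_apply]
  rw [integral_smul]

end SchwartzIntegral

end CohenQuant

namespace CohenQuant

/-! ### Polynomially bounded families of Schwartz functions -/

section PolyBounded

variable {E : Type*} [NormedAddCommGroup E] [NormedSpace ℝ E] {ι : Type*}

/-- A family of Schwartz functions is polynomially bounded with respect to a weight `wt` if all its
Schwartz seminorms are bounded by polynomials in `wt`. -/
def PolyBounded (wt : ι → ℝ) (f : ι → 𝓢(E, ℂ)) : Prop :=
  ∀ k n : ℕ, ∃ C : ℝ, 0 ≤ C ∧ ∃ N : ℕ, ∀ i, SchwartzMap.seminorm ℂ k n (f i) ≤ C * (1 + wt i) ^ N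

variable {wt : ι → ℝ} {f : ι → 𝓢(E, ℂ)}

theorem PolyBounded.const (wt : ι → ℝ) (u : 𝓢(E, ℂ)) :
    PolyBounded wt fun _ : ι => u := fun k n =>
  ⟨SchwartzMap.seminorm ℂ k n u, apply_nonneg _ _, 0, fun i => by simp⟩

/-- Sums of the constants and of the exponents dominate the individual ones, because `1 + wt i ≥ 1`.
-/
theorem PolyBounded.sup_le (hf : PolyBounded wt f) (hwt : ∀ i, 0 ≤ wt i) (s : Finset (ℕ × ℕ)) :
    ∃ C : ℝ, 0 ≤ C ∧ ∃ N : ℕ, ∀ i,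
      s.sup (fun m => SchwartzMap.seminorm ℂ m.1 m.2) (f i) ≤ C * (1 + wt i) ^ N := by
  choose C hC N h using hf
  refine ⟨∑ m ∈ s, C m.1 m.2, Finset.sum_nonneg fun m _ => hC _ _, ∑ m ∈ s, N m.1 m.2,
    fun i => ?_⟩
  have h1 : 1 ≤ 1 + wt i := by linarith [hwt i]
  have h0 : ∀ m ∈ s, 0 ≤ C m.1 m.2 := fun m _ => hC _ _
  have hs := Finset.sum_nonneg h0
  refine Seminorm.finset_sup_apply_le (by positivity) fun m hm => (h m.1 m.2 i).trans ?_
  exact mul_le_mul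
    (Finset.single_le_sum (f := fun m : ℕ × ℕ => C m.1 m.2) h0 hm)
    (pow_le_pow_right₀ h1 (Finset.single_le_sum (f := fun m : ℕ × ℕ => N m.1 m.2)
      (fun m _ => Nat.zero_le _) hm)) (by positivity) hs

theorem exists_seminorm_clm_le (A : 𝓢(E, ℂ) →L[ℂ] 𝓢(E, ℂ)) (k n : ℕ) :
    ∃ (s : Finset (ℕ × ℕ)) (C : ℝ), 0 ≤ C ∧ ∀ u, SchwartzMap.seminorm ℂ k n (A u) ≤
      C * s.sup (fun m => SchwartzMap.seminorm ℂ m.1 m.2) u := by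
  obtain ⟨s, C, -, h⟩ := Seminorm.bound_of_continuous (schwartz_withSeminorms ℂ E ℂ)
    ((schwartzSeminormFamily ℂ E ℂ (k, n)).comp A.toLinearMap)
    (((schwartz_withSeminorms ℂ E ℂ).continuous_seminorm (k, n)).comp A.continuous)
  exact ⟨s, C, C.2, fun u => h u⟩

theorem exists_norm_clm_le (T : 𝓢(E, ℂ) →L[ℂ] ℂ) :
    ∃ (s : Finset (ℕ × ℕ)) (C : ℝ), 0 ≤ C ∧ ∀ u, ‖T u‖ ≤
      C * s.sup (fun m => SchwartzMap.seminorm ℂ m.1 m.2) u := by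
  obtain ⟨s, C, -, h⟩ := Seminorm.bound_of_continuous (schwartz_withSeminorms ℂ E ℂ)
    ((normSeminorm ℂ ℂ).comp T.toLinearMap) (continuous_norm.comp T.continuous)
  exact ⟨s, C, C.2, fun u => h u⟩

theorem PolyBounded.clm (hf : PolyBounded wt f) (hwt : ∀ i, 0 ≤ wt i)
    (A : 𝓢(E, ℂ) →L[ℂ] 𝓢(E, ℂ)) : PolyBounded wt fun i => A (f i) := by
  intro k n
  obtain ⟨s, C, hC, h⟩ := exists_seminorm_clm_le A k n
  obtain ⟨C', hC', N, h'⟩ := hf.sup_le hwt s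
  refine ⟨C * C', by positivity, N, fun i => (h _).trans ?_⟩
  rw [mul_assoc]
  exact mul_le_mul_of_nonneg_left (h' i) hC

theorem PolyBounded.exists_norm_le (hf : PolyBounded wt f) (hwt : ∀ i, 0 ≤ wt i)
    (T : 𝓢(E, ℂ) →L[ℂ] ℂ) : ∃ C : ℝ, 0 ≤ C ∧ ∃ N : ℕ, ∀ i, ‖T (f i)‖ ≤ C * (1 + wt i) ^ N := by
  obtain ⟨s, C, hC, h⟩ := exists_norm_clm_le T
  obtain ⟨C', hC', N, h'⟩ := hf.sup_le hwt s
  refine ⟨C * C', by positivity, N, fun i => (h _).trans ?_⟩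
  rw [mul_assoc]
  exact mul_le_mul_of_nonneg_left (h' i) hC

end PolyBounded

/-- Splitting off `f i` itself, the error term is controlled by `exists_seminorm_dilate_sub_le`,
whose constant depends neither on the scale nor on the function. -/
theorem PolyBounded.dilate {ι : Type*} {wt : ι → ℝ} {f : ι → 𝓢(Phase, ℂ)} (hf : PolyBounded wt f)
    (hwt : ∀ i, 0 ≤ wt i) {χ : 𝓢(Phase, ℂ)} (hχ : χ 0 = 1) {δ : ι → ℝ} (h0 : ∀ i, 0 < δ i)
    (h1 : ∀ i, δ i ≤ 1) :
    PolyBounded wt fun i => SchwartzMap.smulLeftCLM ℂ (dilate (δ i) χ) (f i) := by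
  intro k n
  obtain ⟨C, hC, h⟩ := exists_seminorm_dilate_sub_le χ hχ k n
  obtain ⟨C₁, hC₁, N₁, h₁⟩ := hf.sup_le hwt (Finset.Iic (k + 2, n))
  obtain ⟨C₂, hC₂, N₂, h₂⟩ := hf k n
  refine ⟨C * C₁ + C₂, by positivity, N₁ + N₂, fun i => ?_⟩
  have hi : 1 ≤ 1 + wt i := by linarith [hwt i]
  calc SchwartzMap.seminorm ℂ k n (SchwartzMap.smulLeftCLM ℂ (CohenQuant.dilate (δ i) χ) (f i))
      = SchwartzMap.seminorm ℂ k n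
          ((SchwartzMap.smulLeftCLM ℂ (CohenQuant.dilate (δ i) χ) (f i) - f i) + f i) := by
        rw [sub_add_cancel]
    _ ≤ _ := map_add_le_add _ _ _
    _ ≤ 1 * (C * (C₁ * (1 + wt i) ^ (N₁ + N₂))) + C₂ * (1 + wt i) ^ (N₁ + N₂) := by
        refine add_le_add ((h _ (h0 i) (h1 i) _).trans ?_) ((h₂ i).trans ?_)
        · refine mul_le_mul (h1 i) (mul_le_mul_of_nonneg_left ((h₁ i).trans ?_) hC)
            (mul_nonneg hC (apply_nonneg _ _)) zero_le_one
          exact mul_le_mul_of_nonneg_left (pow_le_pow_right₀ hi (by omega)) hC₁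
        · exact mul_le_mul_of_nonneg_left (pow_le_pow_right₀ hi (by omega)) hC₂
    _ = _ := by ring

/-! ### Modulations of Schwartz functions on the phase space -/

/-- The bilinear form `(v, z) ↦ -ħ⁻¹ (v₀ z₁ - z₀ v₁)`. -/
noncomputable def phaseForm (ħ : ℝ) : Phase →L[ℝ] Phase →L[ℝ] ℝ :=
  (-ħ⁻¹) • ((ContinuousLinearMap.mul ℝ ℝ).bilinearComp (EuclideanSpace.proj (𝕜 := ℝ) 0)
      (EuclideanSpace.proj (𝕜 := ℝ) 1) -
    (ContinuousLinearMap.mul ℝ ℝ).bilinearComp (EuclideanSpace.proj (𝕜 := ℝ) 1)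
      (EuclideanSpace.proj (𝕜 := ℝ) 0))

theorem phaseForm_apply (ħ : ℝ) (v z : Phase) :
    phaseForm ħ v z = -ħ⁻¹ * (v 0 * z 1 - z 0 * v 1) := by
  simp [phaseForm, mul_comm (v 1)]

theorem phaseForm_swap (ħ : ℝ) (v z : Phase) : phaseForm ħ v z = -phaseForm ħ z v := by
  rw [phaseForm_apply, phaseForm_apply]; ring

/-- Multiplication by the character `z ↦ exp (-(i/ħ) (v₀ z₁ - z₀ v₁))`. -/
noncomputable def modul (ħ : ℝ) (v : Phase) : 𝓢(Phase, ℂ) →L[ℂ] 𝓢(Phase, ℂ) :=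
  SchwartzMap.smulLeftCLM ℂ (character (phaseForm ħ v))

theorem modul_apply (ħ : ℝ) (v : Phase) (u : 𝓢(Phase, ℂ)) (z : Phase) :
    modul ħ v u z = character (phaseForm ħ v) z * u z :=
  SchwartzMap.smulLeftCLM_apply_apply (hasTemperateGrowth_character _) u z

theorem modul_add (ħ : ℝ) (v w : Phase) (u : 𝓢(Phase, ℂ)) :
    modul ħ (v + w) u = modul ħ v (modul ħ w u) := by
  ext z
  simp only [modul_apply, character, map_add, add_apply]
  rw [← mul_assoc, ← Complex.exp_add]
  congr 2
  push_cast
  ring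

theorem modul_smulLeftCLM (ħ : ℝ) (v : Phase) {m : Phase → ℂ} (hm : m.HasTemperateGrowth)
    (u : 𝓢(Phase, ℂ)) : modul ħ v (SchwartzMap.smulLeftCLM ℂ m u)
      = SchwartzMap.smulLeftCLM ℂ m (modul ħ v u) := by
  ext z
  simp only [modul_apply, SchwartzMap.smulLeftCLM_apply_apply hm, smul_eq_mul]
  ring

theorem one_add_norm_phaseForm_le (ħ : ℝ) (v : Phase) :
    1 + ‖phaseForm ħ v‖ ≤ (1 + ‖phaseForm ħ‖) * (1 + ‖v‖) := by
  have := (phaseForm ħ).le_opNorm v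
  nlinarith [norm_nonneg v, norm_nonneg (phaseForm ħ)]

theorem PolyBounded.modul {ι : Type*} {wt : ι → ℝ} {f : ι → 𝓢(Phase, ℂ)} (hf : PolyBounded wt f)
    (hwt : ∀ i, 0 ≤ wt i) (ħ : ℝ) {v : ι → Phase} (hv : ∀ i, ‖v i‖ ≤ wt i) :
    PolyBounded wt fun i => modul ħ (v i) (f i) := by
  intro k n
  obtain ⟨C, hC, N, h⟩ := hf.sup_le hwt (Finset.Iic (k + 2, n))
  refine ⟨(1 + ‖phaseForm ħ‖) ^ n * (2 ^ n * 2 ^ (k + 2) * C), by positivity, n + N, fun i =>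
    (seminorm_character_le k n _ _).trans ?_⟩
  have h0 := hwt i
  calc _ ≤ ((1 + ‖phaseForm ħ‖) * (1 + wt i)) ^ n *
        (2 ^ n * 2 ^ (k + 2) * (C * (1 + wt i) ^ N)) := by
        refine mul_le_mul (pow_le_pow_left₀ (by positivity)
          ((one_add_norm_phaseForm_le ħ (v i)).trans ?_) n)
          (mul_le_mul_of_nonneg_left (h i) (by positivity)) (by positivity) (by positivity)
        gcongr
        exact hv i
    _ = _ := by rw [mul_pow]; ring

theorem tendsto_modul_zero (ħ : ℝ) (u : 𝓢(Phase, ℂ)) :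
    Tendsto (fun v => modul ħ v u) (𝓝 0) (𝓝 u) := by
  rw [(schwartz_withSeminorms ℂ Phase ℂ).tendsto_nhds]
  rintro ⟨k, n⟩ r hr
  set q : ℝ := 2 ^ n * 2 ^ (k + 2) *
    (Finset.Iic (k + 2, n)).sup (fun m => SchwartzMap.seminorm ℂ m.1 m.2) u
  have hc : Continuous fun v => ‖phaseForm ħ v‖ * (1 + ‖phaseForm ħ v‖) ^ n * q := by fun_prop
  have ht := hc.tendsto 0
  simp only [map_zero, norm_zero, zero_mul] at ht
  filter_upwards [ht.eventually (gt_mem_nhds hr)] with v hv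
  exact (seminorm_character_sub_le k n (phaseForm ħ v) u).trans_lt hv

theorem continuous_modul (ħ : ℝ) (u : 𝓢(Phase, ℂ)) : Continuous fun v => modul ħ v u := by
  refine continuous_iff_continuousAt.2 fun v₀ => ?_
  have h : Tendsto (fun v => v - v₀) (𝓝 v₀) (𝓝 0) := by
    have : Continuous fun v : Phase => v - v₀ := by fun_prop
    simpa using this.tendsto v₀
  have h2 := (tendsto_modul_zero ħ (modul ħ v₀ u)).comp h
  refine h2.congr fun v => ?_
  rw [Function.comp_apply, ← modul_add, sub_add_cancel]

/-- Joint continuity: the part `modul ħ (v i) (f i - u)` vanishes because `seminorm_character_le`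
bounds modulations uniformly for bounded parameters, and the rest is continuity in the parameter
alone. -/
theorem tendsto_modul_comp (ħ : ℝ) {ι : Type*} {F : Filter ι} {v : ι → Phase} {v₀ : Phase}
    (hv : Tendsto v F (𝓝 v₀)) {f : ι → 𝓢(Phase, ℂ)} {u : 𝓢(Phase, ℂ)}
    (hf : Tendsto f F (𝓝 u)) : Tendsto (fun i => modul ħ (v i) (f i)) F (𝓝 (modul ħ v₀ u)) := by
  have h1 : Tendsto (fun i => modul ħ (v i) u) F (𝓝 (modul ħ v₀ u)) :=
    ((continuous_modul ħ u).tendsto v₀).comp hv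
  have h2 : Tendsto (fun i => modul ħ (v i) (f i - u)) F (𝓝 0) := by
    rw [(schwartz_withSeminorms ℂ Phase ℂ).tendsto_nhds]
    rintro ⟨k, n⟩ r hr
    set q : Seminorm ℂ 𝓢(Phase, ℂ) :=
      (Finset.Iic (k + 2, n)).sup (fun m => SchwartzMap.seminorm ℂ m.1 m.2) with hq
    have hqc : Continuous q := by
      refine Seminorm.continuous_of_le (q := ∑ m ∈ Finset.Iic (k + 2, n),
        SchwartzMap.seminorm ℂ m.1 m.2) ?_ (Seminorm.finset_sup_le_sum _ _)
      have : ⇑(∑ m ∈ Finset.Iic (k + 2, n), SchwartzMap.seminorm ℂ (E := Phase) (F := ℂ) m.1 m.2)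
          = fun u => ∑ m ∈ Finset.Iic (k + 2, n), SchwartzMap.seminorm ℂ m.1 m.2 u := by
        ext u
        rw [← FunLike.coeAddMonoidHom_apply, map_sum, Finset.sum_apply]
        rfl
      rw [this]
      exact continuous_finsetSum _ fun m _ =>
        (schwartz_withSeminorms ℂ Phase ℂ).continuous_seminorm m
    have hfu : Tendsto (fun i => q (f i - u)) F (𝓝 0) := by
      have : Continuous fun g => q (g - u) := hqc.comp (continuous_id.sub continuous_const)
      have h3 := (this.tendsto u).comp hf
      rwa [sub_self, map_zero] at h3
    have hnv : Tendsto (fun i => (1 + ‖phaseForm ħ (v i)‖) ^ n) F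
        (𝓝 ((1 + ‖phaseForm ħ v₀‖) ^ n)) := by
      have : Continuous fun v => (1 + ‖phaseForm ħ v‖) ^ n := by fun_prop
      exact (this.tendsto v₀).comp hv
    have ht := hnv.mul (hfu.const_mul (2 ^ n * 2 ^ (k + 2)))
    simp only [mul_zero] at ht
    filter_upwards [ht.eventually (gt_mem_nhds hr)] with i hi
    rw [sub_zero]
    exact (seminorm_character_le k n (phaseForm ħ (v i)) _).trans_lt hi
  have := h2.add h1
  rw [zero_add] at this
  refine this.congr fun i => ?_
  rw [map_sub, sub_add_cancel]

/-! ### Matrix elements of modulations are slowly increasing -/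

/-- Multiplication by `-(i/ħ) z₁`. -/
noncomputable def mulMomentum (ħ : ℝ) : 𝓢(Phase, ℂ) →L[ℂ] 𝓢(Phase, ℂ) :=
  (-(Complex.I * ħ⁻¹)) • SchwartzMap.smulLeftCLM ℂ (fun z : Phase => ((z 1 : ℝ) : ℂ))

/-- Multiplication by `(i/ħ) z₀`. -/
noncomputable def mulPosition (ħ : ℝ) : 𝓢(Phase, ℂ) →L[ℂ] 𝓢(Phase, ℂ) :=
  (Complex.I * ħ⁻¹) • SchwartzMap.smulLeftCLM ℂ (fun z : Phase => ((z 0 : ℝ) : ℂ))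

theorem hasTemperateGrowth_coord_ofReal (i : Fin 2) :
    (fun z : Phase => ((z i : ℝ) : ℂ)).HasTemperateGrowth :=
  hasTemperateGrowth_ofReal_clm (EuclideanSpace.proj (𝕜 := ℝ) i : Phase →L[ℝ] ℝ)

theorem smulLeftCLM_phaseForm (ħ : ℝ) (v : Phase) (u : 𝓢(Phase, ℂ)) :
    SchwartzMap.smulLeftCLM ℂ (fun z => Complex.I * (phaseForm ħ v z : ℂ)) u
      = ((v 0 : ℝ) : ℂ) • mulMomentum ħ u + ((v 1 : ℝ) : ℂ) • mulPosition ħ u := by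
  have hI : (fun z => Complex.I * (phaseForm ħ v z : ℂ)).HasTemperateGrowth :=
    (Function.HasTemperateGrowth.const Complex.I).mul (hasTemperateGrowth_ofReal_clm _)
  ext z
  rw [SchwartzMap.smulLeftCLM_apply_apply hI]
  simp only [mulMomentum, mulPosition, add_apply, smul_apply,
    SchwartzMap.smulLeftCLM_apply_apply (hasTemperateGrowth_coord_ofReal _), smul_eq_mul,
    phaseForm_apply]
  push_cast
  ring

/-- `c ↦ (v ↦ c vᵢ)`. -/
noncomputable def coordSMul (i : Fin 2) : ℂ →L[ℝ] Phase →L[ℝ] ℂ :=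
  (ContinuousLinearMap.mul ℝ ℂ).bilinearComp (.id ℝ ℂ)
    (Complex.ofRealCLM ∘L (EuclideanSpace.proj (𝕜 := ℝ) i : Phase →L[ℝ] ℝ))

theorem coordSMul_apply (i : Fin 2) (c : ℂ) (v : Phase) : coordSMul i c v = c * (v i : ℝ) := rfl

/-- The derivative is built from functions of the same kind, with `u` multiplied by coordinates;
this is what makes induction on the order of differentiation possible. -/
theorem hasFDerivAt_map_modul (ħ : ℝ) (T : 𝓢(Phase, ℂ) →L[ℂ] ℂ) (u : 𝓢(Phase, ℂ)) (Ω : Phase) :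
    HasFDerivAt (fun Ω => T (modul ħ Ω u))
      (coordSMul 0 (T (modul ħ Ω (mulMomentum ħ u))) +
        coordSMul 1 (T (modul ħ Ω (mulPosition ħ u)))) Ω := by
  obtain ⟨s, C, hC, hT⟩ := exists_norm_clm_le T
  have hcomm : ∀ A ∈ ({mulMomentum ħ, mulPosition ħ} : Set _),
      modul ħ Ω (A u) = A (modul ħ Ω u) := by
    rintro A (rfl | rfl)
    · exact (map_smul (modul ħ Ω) _ _).trans
        (congrArg _ (modul_smulLeftCLM ħ Ω (hasTemperateGrowth_coord_ofReal 1) u))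
    · exact (map_smul (modul ħ Ω) _ _).trans
        (congrArg _ (modul_smulLeftCLM ħ Ω (hasTemperateGrowth_coord_ofReal 0) u))
  set w := modul ħ Ω u with hw
  -- By the group law the base point is absorbed into `w`, and the remainder becomes `T` applied to
  -- the second-order Taylor remainder of the character times `w`.
  have hrem : ∀ v, T (modul ħ (Ω + v) u) - T w -
      (coordSMul 0 (T (modul ħ Ω (mulMomentum ħ u))) +
        coordSMul 1 (T (modul ħ Ω (mulPosition ħ u)))) v =
      T (modul ħ v w - w -
        SchwartzMap.smulLeftCLM ℂ (fun z => Complex.I * (phaseForm ħ v z : ℂ)) w) := by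
    intro v
    rw [smulLeftCLM_phaseForm, hcomm _ (by simp), hcomm _ (by simp), add_comm Ω v, modul_add, ← hw,
      add_apply, coordSMul_apply, coordSMul_apply, map_sub, map_sub, map_add, map_smul, map_smul,
      smul_eq_mul, smul_eq_mul]
    ring
  obtain ⟨D, hD, hbound⟩ : ∃ D : ℝ, 0 ≤ D ∧ ∀ v, ‖v‖ ≤ 1 → ‖T (modul ħ v w - w -
        SchwartzMap.smulLeftCLM ℂ (fun z => Complex.I * (phaseForm ħ v z : ℂ)) w)‖ ≤
          D * ‖v‖ ^ 2 := by
    set κ := ‖phaseForm ħ‖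
    set q : ℕ × ℕ → ℝ := fun m => κ ^ 2 * (1 + κ) ^ m.2 * (2 ^ m.2 * 2 ^ (m.1 + 2) *
        (Finset.Iic (m.1 + 2, m.2)).sup (fun m => SchwartzMap.seminorm ℂ m.1 m.2) w)
    have hq : ∀ m, 0 ≤ q m := fun m => by positivity
    refine ⟨C * ∑ m ∈ s, q m, mul_nonneg hC (Finset.sum_nonneg fun m _ => hq m), fun v hv =>
      (hT _).trans ?_⟩
    rw [mul_assoc]
    refine mul_le_mul_of_nonneg_left ?_ hC
    have hs : 0 ≤ ∑ m ∈ s, q m := Finset.sum_nonneg fun m _ => hq m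
    refine Seminorm.finset_sup_apply_le (by positivity) fun m hm => ?_
    have hl : ‖phaseForm ħ v‖ ≤ κ * ‖v‖ := (phaseForm ħ).le_opNorm v
    have hl1 : ‖phaseForm ħ v‖ ≤ κ :=
      hl.trans (mul_le_of_le_one_right (norm_nonneg (phaseForm ħ)) hv)
    calc _ ≤ _ := seminorm_character_sub_sub_le m.1 m.2 (phaseForm ħ v) w
      _ ≤ (κ * ‖v‖) ^ 2 * (1 + κ) ^ m.2 * (2 ^ m.2 * 2 ^ (m.1 + 2) *
        (Finset.Iic (m.1 + 2, m.2)).sup (fun m => SchwartzMap.seminorm ℂ m.1 m.2) w) := by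
        gcongr
      _ = q m * ‖v‖ ^ 2 := by simp only [q]; ring
      _ ≤ _ := by
        gcongr
        exact Finset.single_le_sum (f := q) (fun m _ => hq m) hm
  rw [hasFDerivAt_iff_isLittleO_nhds_zero]
  refine Asymptotics.IsBigO.trans_isLittleO (g := fun v : Phase => ‖v‖ ^ 2) ?_ ?_
  · refine Asymptotics.IsBigO.of_bound D ?_
    filter_upwards [Metric.closedBall_mem_nhds (0 : Phase) one_pos] with v hv
    rw [hrem, norm_pow, norm_norm]
    exact hbound v (by simpa using hv)
  · exact Asymptotics.isLittleO_norm_pow_id one_lt_two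

theorem hasTemperateGrowth_map_modul (ħ : ℝ) (T : 𝓢(Phase, ℂ) →L[ℂ] ℂ) (u : 𝓢(Phase, ℂ)) :
    (fun Ω => T (modul ħ Ω u)).HasTemperateGrowth := by
  have hf : ∀ u, fderiv ℝ (fun Ω => T (modul ħ Ω u)) =
      (fun Ω => coordSMul 0 (T (modul ħ Ω (mulMomentum ħ u)))) +
        fun Ω => coordSMul 1 (T (modul ħ Ω (mulPosition ħ u))) := fun u =>
    funext fun Ω => (hasFDerivAt_map_modul ħ T u Ω).fderiv
  have hd : ∀ u, Differentiable ℝ fun Ω => T (modul ħ Ω u) := fun u Ω =>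
    (hasFDerivAt_map_modul ħ T u Ω).differentiableAt
  have hc : ∀ (n : ℕ) (u), ContDiff ℝ n fun Ω => T (modul ħ Ω u) := by
    intro n
    induction n with
    | zero => exact fun u => contDiff_zero.2 (hd u).continuous
    | succ n ih =>
      intro u
      push_cast
      refine contDiff_succ_iff_fderiv.2 ⟨hd u, by simp, ?_⟩
      rw [hf u]
      exact ((coordSMul 0).contDiff.comp (ih _)).add ((coordSMul 1).contDiff.comp (ih _))
  -- The growth bounds are proved for all `u` at once, since the derivative replaces `u` by its
  -- products with coordinates.
  refine ⟨contDiff_infty.2 fun n => hc n u, fun n => ?_⟩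
  induction n generalizing u with
  | zero =>
    obtain ⟨C, -, N, h⟩ := ((PolyBounded.const (fun v : Phase => ‖v‖)
      u).modul (fun v => norm_nonneg v) ħ (v := id) fun v => le_rfl).exists_norm_le
        (fun v => norm_nonneg v) T
    exact ⟨N, C, fun v => by simpa using h v⟩
  | succ n ih =>
    obtain ⟨k₀, C₀, h₀⟩ := ih (mulMomentum ħ u)
    obtain ⟨k₁, C₁, h₁⟩ := ih (mulPosition ħ u)
    refine ⟨k₀ + k₁, ‖coordSMul 0‖ * |C₀| + ‖coordSMul 1‖ * |C₁|, fun v => ?_⟩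
    have h1 : (1 : ℝ) ≤ 1 + ‖v‖ := by linarith [norm_nonneg v]
    have hcomp : ∀ (i : Fin 2) (u), ‖iteratedFDeriv ℝ n
        (fun Ω => coordSMul i (T (modul ħ Ω u))) v‖ ≤
          ‖coordSMul i‖ * ‖iteratedFDeriv ℝ n (fun Ω => T (modul ħ Ω u)) v‖ := by
      intro i u
      have := (coordSMul i).iteratedFDeriv_comp_left (hc n u).contDiffAt (x := v) (i := n) le_rfl
      have h2 : (fun Ω => coordSMul i (T (modul ħ Ω u)))
        = coordSMul i ∘ fun Ω => T (modul ħ Ω u) := rfl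
      rw [h2, this]
      exact ContinuousLinearMap.norm_compContinuousMultilinearMap_le _ _
    rw [← norm_iteratedFDeriv_fderiv, hf,
      iteratedFDeriv_add_apply (f := fun Ω => coordSMul 0 (T (modul ħ Ω (mulMomentum ħ u))))
        (g := fun Ω => coordSMul 1 (T (modul ħ Ω (mulPosition ħ u))))
        ((coordSMul 0).contDiff.comp (hc n _)).contDiffAt
        ((coordSMul 1).contDiff.comp (hc n _)).contDiffAt]
    refine (norm_add_le _ _).trans ((add_le_add (hcomp 0 _) (hcomp 1 _)).trans ?_)
    rw [add_mul, mul_assoc, mul_assoc]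
    gcongr
    · refine (h₀ v).trans (mul_le_mul (le_abs_self _) (pow_le_pow_right₀ h1 (by omega))
        (by positivity) (by positivity))
    · refine (h₁ v).trans (mul_le_mul (le_abs_self _) (pow_le_pow_right₀ h1 (by omega))
        (by positivity) (by positivity))

end CohenQuant

namespace CohenQuant

/-! ### Properties of the symplectic Fourier transform -/

/-- The translation `a(Ω) ↦ a(Ω - y)` of Schwartz functions. -/
noncomputable def translate (y : Phase) : 𝓢(Phase, ℂ) →L[ℂ] 𝓢(Phase, ℂ) :=
  SchwartzMap.compSubConstCLM ℂ y

theorem translate_apply (y : Phase) (u : 𝓢(Phase, ℂ)) (z : Phase) :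
    translate y u z = u (z - y) :=
  SchwartzMap.compSubConstCLM_apply u y z

theorem reflect_apply (u : 𝓢(Phase, ℂ)) (z : Phase) : reflect u z = u (-z) := rfl

theorem reflect_reflect (u : 𝓢(Phase, ℂ)) : reflect (reflect u) = u := by
  ext z
  simp [reflect_apply]

theorem modul_reflect (ħ : ℝ) (v : Phase) (u : 𝓢(Phase, ℂ)) :
    modul ħ v (reflect u) = reflect (modul ħ (-v) u) := by
  ext z
  simp [modul_apply, reflect_apply, character]

variable {ħ : ℝ} (hħ : 0 < ħ)

theorem sympFourier_eq_integral (a : 𝓢(Phase, ℂ)) (z : Phase) :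
    sympFourier hħ a z =
      (((2 * Real.pi * ħ)⁻¹ : ℝ) : ℂ) * ∫ w, character (phaseForm ħ w) z * a w := by
  rw [sympFourier_apply]
  push_cast
  congr 1
  refine integral_congr_ae (Eventually.of_forall fun w => ?_)
  simp only [character, phaseForm_apply]
  congr 2
  push_cast
  ring

theorem sympFourier_reflect (a : 𝓢(Phase, ℂ)) :
    sympFourier hħ (reflect a) = reflect (sympFourier hħ a) := by
  ext z
  rw [reflect_apply, sympFourier_eq_integral, sympFourier_eq_integral,
    ← integral_neg_eq_self]
  congr 1
  refine integral_congr_ae (Eventually.of_forall fun w => ?_)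
  simp [character, reflect_apply]

theorem sympFourier_translate (a : 𝓢(Phase, ℂ)) (y : Phase) :
    sympFourier hħ (translate y a) = modul ħ y (sympFourier hħ a) := by
  ext z
  rw [modul_apply, sympFourier_eq_integral, sympFourier_eq_integral,
    ← integral_add_right_eq_self (fun w => character (phaseForm ħ w) z *
      translate y a w) y, mul_left_comm]
  congr 1
  rw [← integral_const_mul]
  refine integral_congr_ae (Eventually.of_forall fun w => ?_)
  simp only [translate_apply, add_sub_cancel_right, character, map_add, add_apply]
  rw [← mul_assoc, ← Complex.exp_add]
  congr 2
  push_cast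
  ring

/-- The rotation `(x, p) ↦ (p, -x)` as a linear isometry. -/
noncomputable def quarterTurn : Phase ≃ₗᵢ[ℝ] Phase :=
  { (rot (-1) (-1) (by norm_num) (by norm_num)).toLinearEquiv with
    norm_map' := fun z => by
      change ‖rot (-1) (-1) _ _ z‖ = ‖z‖
      simp [rot_apply, EuclideanSpace.norm_eq, Fin.sum_univ_two, add_comm] }

theorem quarterTurn_apply (z : Phase) : quarterTurn z = !₂[z 1, -z 0] := by
  refine (rot_apply (-1) (-1) (by norm_num) (by norm_num) z).trans ?_
  simp

/-- An involution without reflection, because exchanging the arguments of the antisymmetric phase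
conjugates the kernel. A quarter turn and a scaling, of Jacobian `c²`, reduce it to ordinary Fourier
inversion. -/
theorem sympFourier_sympFourier (a : 𝓢(Phase, ℂ)) : sympFourier hħ (sympFourier hħ a) = a := by
  ext z
  set c : ℝ := (2 * Real.pi * ħ)⁻¹ with hc
  have hc0 : 0 < c := by positivity
  set H : Phase → ℂ := fun ξ =>
    Complex.exp (↑(2 * Real.pi * inner ℝ ξ z) * Complex.I) * (𝓕 a : 𝓢(Phase, ℂ)) ξ with hH
  have h1 : ∀ w, character (phaseForm ħ w) z * sympFourier hħ a w
      = (c : ℂ) * H (c • quarterTurn w) := by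
    intro w
    have h : sympFourier hħ a w = (c : ℂ) • (𝓕 a : 𝓢(Phase, ℂ)) (rot (-c) (-c)
        (neg_inv_two_pi_mul_ne_zero hħ) (neg_inv_two_pi_mul_ne_zero hħ) w) := rfl
    have hr : rot (-c) (-c) (neg_inv_two_pi_mul_ne_zero hħ) (neg_inv_two_pi_mul_ne_zero hħ) w
        = c • quarterTurn w := by
      ext i
      fin_cases i <;> simp [rot_apply, quarterTurn_apply]
    have he : character (phaseForm ħ w) z
        = Complex.exp (↑(2 * Real.pi * inner ℝ (c • quarterTurn w) z) * Complex.I) := by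
      rw [character, phaseForm_apply, mul_comm Complex.I]
      congr 3
      simp only [quarterTurn_apply, hc, Fin.sum_univ_two, inner, PiLp.smul_apply]
      simp
      field_simp
      ring
    rw [h, hr, he, smul_eq_mul]
    ring
  rw [sympFourier_eq_integral, ← hc]
  simp only [h1]
  rw [integral_const_mul,
    quarterTurn.measurePreserving.integral_comp quarterTurn.toHomeomorph.measurableEmbedding
      (fun v => H (c • v)), Measure.integral_comp_smul]
  have h2 : ∫ ξ, H ξ = a z := by
    have h : a z = (𝓕⁻ (𝓕 a) : 𝓢(Phase, ℂ)) z := by rw [FourierTransform.fourierInv_fourier_eq]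
    rw [h, SchwartzMap.fourierInv_coe, Real.fourierInv_eq']
    simp only [smul_eq_mul, hH]
  rw [h2, finrank_euclideanSpace_fin, abs_of_pos (by positivity), Complex.real_smul]
  have : (c : ℂ) ≠ 0 := by exact_mod_cast hc0.ne'
  push_cast
  field_simp

theorem sympFourier_modul (a : 𝓢(Phase, ℂ)) (y : Phase) :
    sympFourier hħ (modul ħ y a) = translate y (sympFourier hħ a) := by
  rw [← sympFourier_sympFourier hħ (translate y (sympFourier hħ a)),
    sympFourier_translate, sympFourier_sympFourier]

/-- Translations are conjugate to modulations by a continuous map, so they inherit all estimates and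
continuity statements. -/
theorem translate_eq (a : 𝓢(Phase, ℂ)) (y : Phase) :
    translate y a = sympFourier hħ (modul ħ y (sympFourier hħ a)) := by
  rw [sympFourier_modul, sympFourier_sympFourier]

/-- The Parseval identity for the symplectic Fourier transform. -/
theorem integral_mul_sympFourier (a b : 𝓢(Phase, ℂ)) :
    ∫ z, a z * sympFourier hħ (reflect b) z = ∫ z, sympFourier hħ a z * b z := by
  have h := congrArg (fun T : 𝓢'(Phase, ℂ) => T b) (sympFourierDist_coe hħ a)
  have hl : sympFourierDist hħ (SchwartzMap.toTemperedDistributionCLM Phase ℂ volume a) b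
      = ∫ z, reflect (sympFourier hħ b) z * a z :=
    SchwartzMap.toTemperedDistributionCLM_apply_apply volume a (reflect (sympFourier hħ b))
  have hr : SchwartzMap.toTemperedDistributionCLM Phase ℂ volume (sympFourier hħ a) b
      = ∫ w, b w * sympFourier hħ a w :=
    SchwartzMap.toTemperedDistributionCLM_apply_apply volume (sympFourier hħ a) b
  simp only [hl, hr] at h
  rw [sympFourier_reflect]
  simpa only [mul_comm] using h

theorem integral_sympFourier (a : 𝓢(Phase, ℂ)) :
    ∫ z, sympFourier hħ a z = ((2 * Real.pi * ħ : ℝ) : ℂ) * a 0 := by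
  have h := sympFourier_eq_integral hħ (sympFourier hħ a) 0
  have hc : (((2 * Real.pi * ħ : ℝ)) : ℂ) ≠ 0 := by exact_mod_cast (by positivity)
  rw [sympFourier_sympFourier] at h
  simp only [character, map_zero, Complex.ofReal_zero, mul_zero, Complex.exp_zero, one_mul] at h
  rw [h, Complex.ofReal_inv, mul_inv_cancel_left₀ hc]

theorem integrable_one_add_norm_pow_mul (f : 𝓢(Phase, ℂ)) (N : ℕ) :
    Integrable fun z => (1 + ‖z‖) ^ N * ‖f z‖ := by
  have h1 : Integrable fun z => 2 ^ (N - 1) * (1 * ‖f z‖ + ‖z‖ ^ N * ‖f z‖) :=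
    ((f.integrable.norm.const_mul 1).add (SchwartzMap.integrable_pow_mul volume f N)).const_mul _
  refine h1.mono' (by fun_prop) (Eventually.of_forall fun z => ?_)
  rw [Real.norm_of_nonneg (by positivity), ← add_mul, ← mul_assoc]
  gcongr
  simpa using add_pow_le zero_le_one (norm_nonneg z) N

/-- The Fourier transform of the tempered distribution `u T` is the function
`Ω ↦ T(exp(-(i/ħ)(Ω₀ z₁ - z₀ Ω₁)) u(z))`. -/
theorem integral_mul_map_modul (T : 𝓢(Phase, ℂ) →L[ℂ] ℂ) (f u : 𝓢(Phase, ℂ)) :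
    ∫ Ω, f Ω * T (modul ħ Ω u) =
      ((2 * Real.pi * ħ : ℝ) : ℂ) * T (SchwartzMap.smulLeftCLM ℂ (sympFourier hħ f) u) := by
  have hc : (((2 * Real.pi * ħ : ℝ)) : ℂ) ≠ 0 := by exact_mod_cast (by positivity)
  rw [← smul_eq_mul, ← map_smul]
  simp only [← smul_eq_mul (f _), ← map_smul T]
  -- The distribution is pulled out of a Schwartz-valued integral, which converges absolutely
  -- because the decay of `f` beats the polynomial growth of `modul ħ Ω u`.
  refine (map_schwartz_integral T (f := fun Ω => f Ω • modul ħ Ω u)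
    (f.continuous.smul (continuous_modul ħ u)) (fun k n => ?_) fun z => ?_).symm
  · obtain ⟨C, hC, N, h⟩ := (PolyBounded.const (fun v : Phase => ‖v‖) u).modul
      (fun v => norm_nonneg v) ħ (v := id) (fun v => le_rfl) k n
    refine ⟨fun Ω => C * ((1 + ‖Ω‖) ^ N * ‖f Ω‖),
      (integrable_one_add_norm_pow_mul f N).const_mul C, fun Ω => ?_⟩
    rw [map_smul_eq_mul]
    calc _ ≤ ‖f Ω‖ * (C * (1 + ‖Ω‖) ^ N) := by gcongr; exact h Ω
      _ = _ := by ring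
  · rw [smul_apply, SchwartzMap.smulLeftCLM_apply_apply (sympFourier hħ f).hasTemperateGrowth,
      sympFourier_eq_integral, smul_eq_mul, smul_eq_mul, Complex.ofReal_inv, ← mul_assoc,
      mul_inv_cancel_left₀ hc, ← integral_mul_const]
    refine integral_congr_ae (Eventually.of_forall fun w => ?_)
    simp only [smul_apply, modul_apply, smul_eq_mul]
    ring

end CohenQuant

namespace CohenQuant

variable {ħ : ℝ} (hħ : 0 < ħ)

/-! ### Matrix elements of Grossmann-Royer operators -/

theorem grForm_eq_integral (ψ φ : 𝓢(ℝ, ℂ)) (z : Phase) :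
    grForm hħ ψ φ z =
      ∫ x, φ x * (Complex.exp (Complex.I * ((ħ⁻¹ * (2 * z 1 * (x - z 0)) : ℝ) : ℂ)) *
        ψ (2 * z 0 - x)) := by
  have h : grForm hħ ψ φ z = dispForm hħ (parity ψ) φ ((2 : ℝ) • z) := rfl
  rw [h, dispForm_apply]
  refine integral_congr_ae (Eventually.of_forall fun x => ?_)
  simp only [disp_apply, parity_apply, PiLp.smul_apply, smul_eq_mul, neg_sub]
  congr 3
  push_cast
  ring

/-- Covariance of the Grossmann-Royer operators: displacing both test functions amounts to a shift
of phase space, after the substitution `x ↦ x + Ω 0`. -/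
theorem grForm_displaced (ψ φ : 𝓢(ℝ, ℂ)) (Ω : Phase) :
    grForm hħ (dispAdj ħ Ω ψ) (disp ħ !₂[-Ω 0, Ω 1] φ) = translate (-Ω) (grForm hħ ψ φ) := by
  ext z
  rw [translate_apply, grForm_eq_integral, grForm_eq_integral,
    ← integral_add_right_eq_self (fun x => φ x * _) (Ω 0)]
  refine integral_congr_ae (Eventually.of_forall fun x => ?_)
  simp only [dispAdj, disp_apply]
  have e1 : x - (!₂[-Ω 0, Ω 1] : Phase) 0 = x + Ω 0 := by simp
  have e2 : 2 * z 0 - x - (-Ω) 0 = 2 * (z - -Ω) 0 - (x + Ω 0) := by simp; ring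
  rw [e1, e2]
  rw [show ∀ a b c d e : ℂ, a * b * (c * (d * e)) = b * ((a * c * d) * e) by intros; ring]
  rw [← Complex.exp_add, ← Complex.exp_add]
  congr 3
  simp
  ring

/-- One-dimensional Fourier inversion at scale `ħ`: formally, the `p`-integral is `2πħ` times a
delta at `y = -t`. -/
theorem integral_cexp_mul_fourier {ħ : ℝ} (hħ : 0 < ħ) (Φ : 𝓢(ℝ, ℂ)) (t : ℝ) :
    ∫ p : ℝ, Complex.exp (Complex.I * ((ħ⁻¹ * (t * p) : ℝ) : ℂ)) *
      ∫ y, Complex.exp (Complex.I * ((ħ⁻¹ * (p * y) : ℝ) : ℂ)) * Φ y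
      = ((2 * Real.pi * ħ : ℝ) : ℂ) * Φ (-t) := by
  set c : ℝ := -(2 * Real.pi * ħ)⁻¹ with hc
  have hc0 : c ≠ 0 := neg_inv_two_pi_mul_ne_zero hħ
  have hinner : ∀ p : ℝ, ∫ y, Complex.exp (Complex.I * ((ħ⁻¹ * (p * y) : ℝ) : ℂ)) * Φ y
      = (𝓕 Φ : 𝓢(ℝ, ℂ)) (c * p) := by
    intro p
    rw [SchwartzMap.fourier_coe, Real.fourier_eq']
    refine integral_congr_ae (Eventually.of_forall fun y => ?_)
    simp only [smul_eq_mul]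
    congr 2
    rw [mul_comm Complex.I]
    congr 2
    simp only [hc, RCLike.inner_apply, conj_trivial]
    field_simp
  have hsub := Measure.integral_comp_mul_left (fun ξ : ℝ =>
    Complex.exp (↑(2 * Real.pi * (ξ * (-t))) * Complex.I) * (𝓕 Φ : 𝓢(ℝ, ℂ)) ξ) c
  have hinv : ∫ ξ : ℝ, Complex.exp (↑(2 * Real.pi * (ξ * (-t))) * Complex.I) *
      (𝓕 Φ : 𝓢(ℝ, ℂ)) ξ = Φ (-t) := by
    have h : Φ (-t) = (𝓕⁻ (𝓕 Φ) : 𝓢(ℝ, ℂ)) (-t) := by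
      rw [FourierTransform.fourierInv_fourier_eq]
    rw [h, SchwartzMap.fourierInv_coe, Real.fourierInv_eq']
    simp only [smul_eq_mul]
    refine integral_congr_ae (Eventually.of_forall fun ξ => ?_)
    simp [mul_comm]
  rw [hinv, Complex.real_smul] at hsub
  simp only [hinner]
  have habs : |c⁻¹| = 2 * Real.pi * ħ := by
    rw [hc, inv_neg, inv_inv, abs_neg, abs_of_pos (by positivity)]
  rw [← habs, ← hsub]
  refine integral_congr_ae (Eventually.of_forall fun p => ?_)
  simp only
  congr 2
  rw [mul_comm Complex.I]
  congr 2
  rw [hc]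
  field_simp

/-- The product `y ↦ φ(y + q/2) ψ(y - q/2)`. -/
noncomputable def midpointProduct (φ ψ : 𝓢(ℝ, ℂ)) (q : ℝ) : 𝓢(ℝ, ℂ) :=
  SchwartzMap.smulLeftCLM ℂ (SchwartzMap.compSubConstCLM ℂ (-(q / 2)) φ : 𝓢(ℝ, ℂ))
    (SchwartzMap.compSubConstCLM ℂ (q / 2) ψ)

theorem midpointProduct_apply (φ ψ : 𝓢(ℝ, ℂ)) (q y : ℝ) :
    midpointProduct φ ψ q y = φ (y + q / 2) * ψ (y - q / 2) := by
  rw [midpointProduct, SchwartzMap.smulLeftCLM_apply_apply (SchwartzMap.hasTemperateGrowth _),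
    SchwartzMap.compSubConstCLM_apply, SchwartzMap.compSubConstCLM_apply, smul_eq_mul,
    sub_neg_eq_add]

/-- In centred coordinates the phase `-pq/2` of the displacement cancels, leaving a pure Fourier
transform in `y`. -/
theorem dispForm_eq_integral (ψ φ : 𝓢(ℝ, ℂ)) (q p : ℝ) :
    dispForm hħ ψ φ !₂[q, p] = ∫ y, Complex.exp (Complex.I * ((ħ⁻¹ * (p * y) : ℝ) : ℂ)) *
      midpointProduct φ ψ q y := by
  rw [dispForm_apply, ← integral_add_right_eq_self _ (q / 2)]
  refine integral_congr_ae (Eventually.of_forall fun y => ?_)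
  simp only [disp_apply, midpointProduct_apply, Matrix.cons_val_zero, Matrix.cons_val_one]
  rw [mul_left_comm]
  have : y + q / 2 - q = y - q / 2 := by ring
  rw [this]
  congr 2
  push_cast
  ring

/-- Grossmann-Royer operators are symplectic Fourier transforms of displacement operators. -/
theorem sympFourier_dispForm (ψ φ : 𝓢(ℝ, ℂ)) :
    sympFourier hħ (dispForm hħ ψ φ) = (2 : ℂ) • reflect (grForm hħ ψ φ) := by
  ext z
  have hc : (((2 * Real.pi * ħ : ℝ)) : ℂ) ≠ 0 := by exact_mod_cast (by positivity)
  rw [sympFourier_eq_integral, integral_phase]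
  swap
  · refine (dispForm hħ ψ φ).integrable.bdd_mul (c := 1) ?_ ?_
    · simp only [character]
      exact Continuous.aestronglyMeasurable (by fun_prop)
    · exact Eventually.of_forall fun w => (norm_character _ _).le
  -- The `p`-integral is inverted and sets `y = -z 0`.
  have hinner : ∀ q : ℝ, ∫ p : ℝ, character (phaseForm ħ !₂[q, p]) z * dispForm hħ ψ φ !₂[q, p]
      = Complex.exp (Complex.I * ((-ħ⁻¹ * (q * z 1) : ℝ) : ℂ)) *
        (((2 * Real.pi * ħ : ℝ) : ℂ) * midpointProduct φ ψ q (-z 0)) := by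
    intro q
    rw [← integral_cexp_mul_fourier hħ, ← integral_const_mul]
    refine integral_congr_ae (Eventually.of_forall fun p => ?_)
    simp only [dispForm_eq_integral]
    rw [← mul_assoc, ← Complex.exp_add, character, phaseForm_apply]
    congr 2
    simp
    ring
  simp only [hinner]
  set k : ℝ → ℂ := fun x => φ x *
    (Complex.exp (Complex.I * ((ħ⁻¹ * (2 * (-z) 1 * (x - (-z) 0)) : ℝ) : ℂ)) *
        ψ (2 * (-z) 0 - x)) with hk
  -- The remaining integral is that of `grForm` at `-z` with `x = q/2 - z 0`; the Jacobian of this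
  -- substitution is the factor `2`.
  have hq : ∀ q : ℝ, Complex.exp (Complex.I * ((-ħ⁻¹ * (q * z 1) : ℝ) : ℂ)) *
        (((2 * Real.pi * ħ : ℝ) : ℂ) * midpointProduct φ ψ q (-z 0))
      = ((2 * Real.pi * ħ : ℝ) : ℂ) * (fun x => k (x - z 0)) (2⁻¹ * q) := by
    intro q
    simp only [hk, midpointProduct_apply]
    rw [mul_left_comm]
    congr 1
    rw [mul_left_comm]
    have e1 : -z 0 + q / 2 = 2⁻¹ * q - z 0 := by ring
    have e2 : -z 0 - q / 2 = 2 * (-z) 0 - (2⁻¹ * q - z 0) := by simp; ring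
    rw [e1, e2]
    congr 4
    simp only [PiLp.neg_apply]
    ring_nf
  simp only [hq]
  rw [integral_const_mul, Measure.integral_comp_mul_left (fun x => k (x - z 0)),
    integral_sub_right_eq_self k,
    Complex.ofReal_inv, inv_mul_cancel_left₀ hc, smul_apply, reflect_apply, grForm_eq_integral,
    inv_inv, abs_two, Complex.real_smul, smul_eq_mul, Complex.ofReal_ofNat]

/-- The transform is moved from the kernel onto the matrix elements; the constants combine to
`(4πħ)⁻¹ · 2πħ · 2 = 1`. -/
theorem parityCohen_eq_integralGR (θ : 𝓢'(Phase, ℂ)) :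
    parityCohen hħ θ = integralGR hħ (reflectDist θ) := by
  ext ψ φ
  have h1 : parityCohen hħ θ ψ φ = (((4 * Real.pi * ħ)⁻¹ : ℝ) : ℂ) *
      (((2 * Real.pi * ħ : ℝ) : ℂ) *
        θ (reflect (sympFourier hħ (reflect (dispForm hħ ψ φ))))) := rfl
  have h2 : integralGR hħ (reflectDist θ) ψ φ = θ (reflect (grForm hħ ψ φ)) := rfl
  rw [h1, h2, sympFourier_reflect, reflect_reflect, sympFourier_dispForm, map_smul, smul_eq_mul]
  have hπ : (Real.pi : ℂ) ≠ 0 := by exact_mod_cast Real.pi_ne_zero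
  have hħ' : (ħ : ℂ) ≠ 0 := by exact_mod_cast hħ.ne'
  push_cast
  field_simp
  norm_num

theorem displaced_parityCohen (θ : 𝓢'(Phase, ℂ)) (Ω : Phase) (ψ φ : 𝓢(ℝ, ℂ)) :
    displaced ħ Ω (parityCohen hħ θ) ψ φ = reflectDist θ (translate (-Ω) (grForm hħ ψ φ)) := by
  rw [parityCohen_eq_integralGR, ← grForm_displaced]
  rfl

end CohenQuant

namespace CohenQuant

/-! ### Products and Fourier transforms of tempered distributions -/

theorem toTemperedDistribution_eq_integral {f : Phase → ℂ} (hf : f.HasTemperateGrowth)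
    (u : 𝓢(Phase, ℂ)) : hf.toTemperedDistribution volume u = ∫ z, u z * f z :=
  Function.HasTemperateGrowth.toTemperedDistribution_apply volume hf u

/-- `mulDist` picks the representing function by choice; uniqueness allows any given one to replace
it. -/
theorem eq_of_toTemperedDistribution_eq {f g : Phase → ℂ} (hf : f.HasTemperateGrowth)
    (hg : g.HasTemperateGrowth)
    (h : hf.toTemperedDistribution volume = hg.toTemperedDistribution volume) : f = g := by
  have hfc : Continuous f := hf.1.continuous
  have hgc : Continuous g := hg.1.continuous
  refine (Continuous.ae_eq_iff_eq volume hfc hgc).1 ?_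
  refine ae_eq_of_integral_contDiff_smul_eq hfc.locallyIntegrable hgc.locallyIntegrable
    fun φ hφ hs => ?_
  have hs' : HasCompactSupport fun z => (φ z : ℂ) := hs.comp_left Complex.ofReal_zero
  have hφ' : ContDiff ℝ ∞ fun z => (φ z : ℂ) := Complex.ofRealCLM.contDiff.comp hφ
  have := congrArg (fun T : 𝓢'(Phase, ℂ) => T (hs'.toSchwartzMap hφ')) h
  simpa [toTemperedDistribution_eq_integral] using this

theorem toTemperedDistribution_smulLeftCLM {f g : Phase → ℂ} (hf : f.HasTemperateGrowth)
    (hg : g.HasTemperateGrowth) (u : 𝓢(Phase, ℂ)) :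
    hf.toTemperedDistribution volume (SchwartzMap.smulLeftCLM ℂ g u)
      = hg.toTemperedDistribution volume (SchwartzMap.smulLeftCLM ℂ f u) := by
  rw [toTemperedDistribution_eq_integral,
    toTemperedDistribution_eq_integral]
  refine integral_congr_ae (Eventually.of_forall fun z => ?_)
  simp only [SchwartzMap.smulLeftCLM_apply_apply hf, SchwartzMap.smulLeftCLM_apply_apply hg,
    smul_eq_mul]
  ring

theorem mulDist_of_left {f : Phase → ℂ} (hf : f.HasTemperateGrowth) {S T : 𝓢'(Phase, ℂ)}
    (hS : S = hf.toTemperedDistribution volume) :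
    mulDist S T = TemperedDistribution.smulLeftCLM ℂ f T := by
  have h : IsSlowlyIncreasing S := ⟨f, hf, hS⟩
  obtain ⟨hg, hgS⟩ := h.choose_spec
  rw [mulDist, dif_pos h, eq_of_toTemperedDistribution_eq hg hf (hgS.symm.trans hS)]

theorem mulDist_of_right {f : Phase → ℂ} (hf : f.HasTemperateGrowth) {S T : 𝓢'(Phase, ℂ)}
    (hT : T = hf.toTemperedDistribution volume) :
    mulDist S T = TemperedDistribution.smulLeftCLM ℂ f S := by
  -- If both factors are slowly increasing, the definition multiplies by the left one, so
  -- commutativity of the product is needed.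
  by_cases hS : IsSlowlyIncreasing S
  · obtain ⟨g, hg, hgS⟩ := hS
    rw [mulDist_of_left hg hgS, hT, hgS]
    ext u
    rw [TemperedDistribution.smulLeftCLM_apply_apply, TemperedDistribution.smulLeftCLM_apply_apply]
    exact toTemperedDistribution_smulLeftCLM hf hg u
  · have h : IsSlowlyIncreasing T := ⟨f, hf, hT⟩
    obtain ⟨hg, hgT⟩ := h.choose_spec
    rw [mulDist, dif_neg hS, dif_pos h, eq_of_toTemperedDistribution_eq hg hf (hgT.symm.trans hT)]

variable {ħ : ℝ} (hħ : 0 < ħ)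

theorem sympFourierDist_apply (T : 𝓢'(Phase, ℂ)) (u : 𝓢(Phase, ℂ)) :
    sympFourierDist hħ T u = T (reflect (sympFourier hħ u)) := rfl

theorem reflectDist_apply (T : 𝓢'(Phase, ℂ)) (u : 𝓢(Phase, ℂ)) :
    reflectDist T u = T (reflect u) := rfl

theorem sympFourierDist_sympFourierDist (T : 𝓢'(Phase, ℂ)) :
    sympFourierDist hħ (sympFourierDist hħ T) = T := by
  ext u
  rw [sympFourierDist_apply, sympFourierDist_apply, sympFourier_reflect, reflect_reflect,
    sympFourier_sympFourier]

theorem map_translate_eq (S : 𝓢'(Phase, ℂ)) (g : 𝓢(Phase, ℂ)) (Ω : Phase) :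
    S (translate (-Ω) g) =
      sympFourierDist hħ S (modul ħ Ω (reflect (sympFourier hħ g))) := by
  rw [sympFourierDist_apply, modul_reflect, sympFourier_reflect, reflect_reflect,
    translate_eq hħ]

theorem conv_apply_of_left {n : Phase → ℂ} (hn : n.HasTemperateGrowth) {a S : 𝓢'(Phase, ℂ)}
    (ha : sympFourierDist hħ a = hn.toTemperedDistribution volume) (g : 𝓢(Phase, ℂ)) :
    conv hħ a S g = ((2 * Real.pi * ħ : ℝ) : ℂ) *
      sympFourierDist hħ S (SchwartzMap.smulLeftCLM ℂ n (reflect (sympFourier hħ g))) := by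
  rw [conv, mulDist_of_left hn ha]
  rfl

theorem conv_apply_of_right {m : Phase → ℂ} (hm : m.HasTemperateGrowth) {a S : 𝓢'(Phase, ℂ)}
    (hS : sympFourierDist hħ S = hm.toTemperedDistribution volume) (g : 𝓢(Phase, ℂ)) :
    conv hħ a S g = ((2 * Real.pi * ħ : ℝ) : ℂ) *
      a (reflect (sympFourier hħ
        (SchwartzMap.smulLeftCLM ℂ m (reflect (sympFourier hħ g))))) := by
  rw [conv, mulDist_of_right hm hS]
  rfl

/-- When the transform is a function `m`, the matrix element is the Fourier transform of the
Schwartz function `m u`, hence Schwartz. -/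
theorem map_modul_of_eq {m : Phase → ℂ} (hm : m.HasTemperateGrowth) {T : 𝓢'(Phase, ℂ)}
    (hT : T = hm.toTemperedDistribution volume) (u : 𝓢(Phase, ℂ)) (Ω : Phase) :
    T (modul ħ Ω u) = ((2 * Real.pi * ħ : ℝ) : ℂ) *
      reflect (sympFourier hħ (SchwartzMap.smulLeftCLM ℂ m u)) Ω := by
  have hc : (((2 * Real.pi * ħ : ℝ)) : ℂ) ≠ 0 := by exact_mod_cast (by positivity)
  rw [hT, toTemperedDistribution_eq_integral, reflect_apply,
    sympFourier_eq_integral, Complex.ofReal_inv, mul_inv_cancel_left₀ hc]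
  refine integral_congr_ae (Eventually.of_forall fun w => ?_)
  simp only [modul_apply, SchwartzMap.smulLeftCLM_apply_apply hm, character, smul_eq_mul, map_neg]
  rw [← phaseForm_swap]
  ring

/-! ### Convolutions as regularized integrals -/

theorem PolyBounded.translate {ι : Type*} {wt : ι → ℝ} {f : ι → 𝓢(Phase, ℂ)}
    (hf : PolyBounded wt f) (hwt : ∀ i, 0 ≤ wt i) {v : ι → Phase} (hv : ∀ i, ‖v i‖ ≤ wt i) :
    PolyBounded wt fun i => translate (v i) (f i) := by
  -- Translations do not depend on `ħ`, so conjugation with the transform for `ħ = 1` suffices.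
  have h := ((hf.clm hwt (sympFourier one_pos)).modul hwt 1 hv).clm hwt (sympFourier one_pos)
  simpa only [← translate_eq] using h

theorem tendsto_translate_comp {ι : Type*} {F : Filter ι} {v : ι → Phase} {v₀ : Phase}
    (hv : Tendsto v F (𝓝 v₀)) {f : ι → 𝓢(Phase, ℂ)} {u : 𝓢(Phase, ℂ)}
    (hf : Tendsto f F (𝓝 u)) :
    Tendsto (fun i => translate (v i) (f i)) F (𝓝 (translate v₀ u)) := by
  have h1 := ((sympFourier one_pos).continuous.tendsto u).comp hf
  have h2 := ((sympFourier one_pos).continuous.tendsto _).comp (tendsto_modul_comp 1 hv h1)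
  rw [← translate_eq] at h2
  refine h2.congr fun i => ?_
  simp only [Function.comp_apply, ← translate_eq]

/-- The product of `u` with the translate by `y` of a function `n` of temperate growth. -/
noncomputable def mulTranslate (n : Phase → ℂ) (u : 𝓢(Phase, ℂ)) (y : Phase) : 𝓢(Phase, ℂ) :=
  translate y (SchwartzMap.smulLeftCLM ℂ n (translate (-y) u))

theorem mulTranslate_apply {n : Phase → ℂ} (hn : n.HasTemperateGrowth) (u : 𝓢(Phase, ℂ))
    (y z : Phase) : mulTranslate n u y z = n (z - y) * u z := by
  rw [mulTranslate, translate_apply, SchwartzMap.smulLeftCLM_apply_apply hn, translate_apply,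
    smul_eq_mul, sub_neg_eq_add, sub_add_cancel]

theorem mulTranslate_zero {n : Phase → ℂ} (hn : n.HasTemperateGrowth) (u : 𝓢(Phase, ℂ)) :
    mulTranslate n u 0 = SchwartzMap.smulLeftCLM ℂ n u := by
  ext z
  rw [mulTranslate_apply hn, SchwartzMap.smulLeftCLM_apply_apply hn, sub_zero, smul_eq_mul]

theorem continuous_mulTranslate (n : Phase → ℂ) (u : 𝓢(Phase, ℂ)) :
    Continuous (mulTranslate n u) := by
  refine continuous_iff_continuousAt.2 fun y => ?_
  refine tendsto_translate_comp tendsto_id ?_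
  refine ((SchwartzMap.smulLeftCLM ℂ n).continuous.tendsto _).comp ?_
  exact tendsto_translate_comp (continuous_neg.tendsto y) tendsto_const_nhds

theorem exists_norm_map_mulTranslate_le (T : 𝓢(Phase, ℂ) →L[ℂ] ℂ) {n : Phase → ℂ}
    (u : 𝓢(Phase, ℂ)) :
    ∃ C : ℝ, 0 ≤ C ∧ ∃ N : ℕ, ∀ y, ‖T (mulTranslate n u y)‖ ≤ C * (1 + ‖y‖) ^ N :=
  ((((PolyBounded.const (fun y : Phase => ‖y‖) u).translate (fun y => norm_nonneg y)
    (v := fun y => -y) fun y => (norm_neg y).le).clm (fun y => norm_nonneg y)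
      (SchwartzMap.smulLeftCLM ℂ n)).translate (fun y => norm_nonneg y)
        (v := fun y => y) fun _ => le_rfl).exists_norm_le (fun y => norm_nonneg y) T

/-- The cut-off is moved from `n` to the Schwartz factor, where its convergence and uniform bounds
are known. -/
theorem mulTranslate_cutoff {n : Phase → ℂ} (hn : n.HasTemperateGrowth) (χ u : 𝓢(Phase, ℂ))
    (y : Phase) : mulTranslate (SchwartzMap.smulLeftCLM ℂ n χ) u y =
      translate y
        (SchwartzMap.smulLeftCLM ℂ n (SchwartzMap.smulLeftCLM ℂ χ (translate (-y) u))) := by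
  ext z
  rw [mulTranslate_apply (SchwartzMap.hasTemperateGrowth _), translate_apply,
    SchwartzMap.smulLeftCLM_apply_apply hn, SchwartzMap.smulLeftCLM_apply_apply hn,
    SchwartzMap.smulLeftCLM_apply_apply χ.hasTemperateGrowth, translate_apply,
    sub_neg_eq_add, sub_add_cancel, smul_eq_mul, smul_eq_mul, smul_eq_mul, mul_assoc]

theorem tendsto_mulTranslate_cutoff {n : Phase → ℂ} (hn : n.HasTemperateGrowth)
    {χ : 𝓢(Phase, ℂ)} (hχ : χ 0 = 1) (u : 𝓢(Phase, ℂ)) (y : Phase) :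
    Tendsto (fun δ => mulTranslate (SchwartzMap.smulLeftCLM ℂ n (dilate δ χ)) u y) (𝓝[>] 0)
      (𝓝 (mulTranslate n u y)) := by
  simp only [mulTranslate_cutoff hn]
  exact ((translate y).continuous.tendsto _).comp
    (((SchwartzMap.smulLeftCLM ℂ n).continuous.tendsto _).comp
      (tendsto_smulLeftCLM_dilate χ hχ _))

theorem exists_norm_map_mulTranslate_cutoff_le (T : 𝓢(Phase, ℂ) →L[ℂ] ℂ) {n : Phase → ℂ}
    (hn : n.HasTemperateGrowth) {χ : 𝓢(Phase, ℂ)} (hχ : χ 0 = 1) (u : 𝓢(Phase, ℂ)) :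
    ∃ C : ℝ, 0 ≤ C ∧ ∃ N : ℕ, ∀ δ : ℝ, 0 < δ → δ ≤ 1 → ∀ y,
      ‖T (mulTranslate (SchwartzMap.smulLeftCLM ℂ n (dilate δ χ)) u y)‖ ≤ C * (1 + ‖y‖) ^ N := by
  -- The scale `δ` is part of the index but not of the weight, which makes the bound uniform in `δ`.
  have h0 : ∀ i : Set.Ioc (0 : ℝ) 1 × Phase, 0 ≤ ‖i.2‖ := fun i => norm_nonneg _
  obtain ⟨C, hC, N, h⟩ := (((((PolyBounded.const (fun i : Set.Ioc (0 : ℝ) 1 × Phase => ‖i.2‖)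
    u).translate h0 (v := fun i => -i.2) fun i => (norm_neg _).le).dilate h0 hχ
      (δ := fun i => i.1) (fun i => i.1.2.1) fun i => i.1.2.2).clm h0
        (SchwartzMap.smulLeftCLM ℂ n)).translate h0 (v := fun i => i.2)
          fun i => le_rfl).exists_norm_le h0 T
  refine ⟨C, hC, N, fun δ hδ hδ1 y => ?_⟩
  rw [mulTranslate_cutoff hn]
  exact h (⟨δ, hδ, hδ1⟩, y)

/-- A convolution theorem: the function of `Ω` is the transform of `u T`, so its product with the
transform of `f` transforms back into a convolution of `f` with `u T`. -/
theorem sympFourier_reflect_smulLeftCLM_map_modul (T : 𝓢(Phase, ℂ) →L[ℂ] ℂ) (f u : 𝓢(Phase, ℂ))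
    (y : Phase) :
    sympFourier hħ (reflect (SchwartzMap.smulLeftCLM ℂ (fun Ω => T (modul ħ Ω u))
      (sympFourier hħ f))) y = T (mulTranslate f u y) := by
  have hc : (((2 * Real.pi * ħ : ℝ)) : ℂ) ≠ 0 := by exact_mod_cast (by positivity)
  have h : SchwartzMap.smulLeftCLM ℂ (sympFourier hħ (modul ħ y (sympFourier hħ f))) u
      = mulTranslate f u y := by
    ext z
    rw [mulTranslate_apply f.hasTemperateGrowth, ← translate_eq,
      SchwartzMap.smulLeftCLM_apply_apply (SchwartzMap.hasTemperateGrowth _), translate_apply,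
      smul_eq_mul]
  rw [sympFourier_reflect, reflect_apply, sympFourier_eq_integral, ← h,
    ← mul_right_inj' hc, ← integral_mul_map_modul, Complex.ofReal_inv, mul_inv_cancel_left₀ hc]
  refine integral_congr_ae (Eventually.of_forall fun w => ?_)
  simp only [modul_apply, character, map_neg,
    SchwartzMap.smulLeftCLM_apply_apply (hasTemperateGrowth_map_modul ħ T u), smul_eq_mul]
  rw [← phaseForm_swap]
  ring

/-- By Parseval on each side, both integrals equal `∫ (F_σ f) g (F_σ η)` with `g(Ω) = T(modul ħ Ω
u)`, which is symmetric in `f` and `η`. -/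
theorem integral_sympFourier_reflect_smulLeftCLM (T : 𝓢(Phase, ℂ) →L[ℂ] ℂ) (f u η : 𝓢(Phase, ℂ)) :
    ∫ z, f z * sympFourier hħ (reflect (SchwartzMap.smulLeftCLM ℂ (fun Ω => T (modul ħ Ω u))
      (sympFourier hħ η))) z = ∫ y, η y * T (mulTranslate f u y) := by
  simp only [← sympFourier_reflect_smulLeftCLM_map_modul hħ]
  rw [integral_mul_sympFourier, integral_mul_sympFourier]
  refine integral_congr_ae (Eventually.of_forall fun z => ?_)
  simp only [SchwartzMap.smulLeftCLM_apply_apply (hasTemperateGrowth_map_modul ħ T u), smul_eq_mul]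
  ring

/-- Extends the preceding identity from a Schwartz `f` to the slowly increasing `n`: it holds for `n
χ(δ ·)`, and dominated convergence lets `δ → 0`. -/
theorem map_smulLeftCLM_map_modul {n : Phase → ℂ} (hn : n.HasTemperateGrowth)
    {a : 𝓢'(Phase, ℂ)} (ha : sympFourierDist hħ a = hn.toTemperedDistribution volume)
    (T : 𝓢(Phase, ℂ) →L[ℂ] ℂ) (u η : 𝓢(Phase, ℂ)) {χ : 𝓢(Phase, ℂ)} (hχ : χ 0 = 1) :
    a (SchwartzMap.smulLeftCLM ℂ (fun Ω => T (modul ħ Ω u)) (sympFourier hħ η))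
      = ∫ y, η y * T (mulTranslate n u y) := by
  set X := SchwartzMap.smulLeftCLM ℂ (fun Ω => T (modul ħ Ω u)) (sympFourier hħ η) with hX
  have h1 : Tendsto (fun δ => hn.toTemperedDistribution volume
      (SchwartzMap.smulLeftCLM ℂ (dilate δ χ) (sympFourier hħ (reflect X))))
        (𝓝[>] 0) (𝓝 (a X)) := by
    have h : a X = hn.toTemperedDistribution volume (sympFourier hħ (reflect X)) := by
      rw [← ha, sympFourierDist_apply, sympFourier_sympFourier, reflect_reflect]
    rw [h]
    exact ((hn.toTemperedDistribution volume).continuous.tendsto _).comp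
      (tendsto_smulLeftCLM_dilate χ hχ _)
  have h2 : ∀ δ, hn.toTemperedDistribution volume
      (SchwartzMap.smulLeftCLM ℂ (dilate δ χ) (sympFourier hħ (reflect X)))
        = ∫ y, η y * T (mulTranslate (SchwartzMap.smulLeftCLM ℂ n (dilate δ χ)) u y) := by
    intro δ
    rw [← integral_sympFourier_reflect_smulLeftCLM hħ, ← hX,
      toTemperedDistribution_eq_integral]
    refine integral_congr_ae (Eventually.of_forall fun z => ?_)
    simp only [SchwartzMap.smulLeftCLM_apply_apply hn,
      SchwartzMap.smulLeftCLM_apply_apply (dilate δ χ).hasTemperateGrowth, smul_eq_mul]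
    ring
  simp only [h2] at h1
  refine tendsto_nhds_unique h1 ?_
  obtain ⟨C, hC, N, h⟩ := exists_norm_map_mulTranslate_cutoff_le T hn hχ u
  refine tendsto_integral_filter_of_dominated_convergence
    (fun y => C * ((1 + ‖y‖) ^ N * ‖η y‖)) (Eventually.of_forall fun δ => ?_) ?_
    ((integrable_one_add_norm_pow_mul η N).const_mul C)
    (Eventually.of_forall fun y => ?_)
  · simp only [← sympFourier_reflect_smulLeftCLM_map_modul hħ]
    exact Continuous.aestronglyMeasurable (by fun_prop)
  · filter_upwards [Ioc_mem_nhdsGT one_pos] with δ hδ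
    refine Eventually.of_forall fun y => ?_
    rw [norm_mul]
    calc _ ≤ ‖η y‖ * (C * (1 + ‖y‖) ^ N) := by gcongr; exact h δ hδ.1 hδ.2 y
      _ = _ := by ring
  · exact ((T.continuous.tendsto _).comp (tendsto_mulTranslate_cutoff hn hχ u y)).const_mul _

/-! ### Removal of the cut-off `χ(ε ·)` by concentration of its transform. -/

theorem integral_comp_smul_phase {ε : ℝ} (hε : ε ≠ 0) (f : Phase → ℂ) :
    ∫ z, f z = ((ε ^ 2 : ℝ) : ℂ) * ∫ z, f (ε • z) := by
  rw [Measure.integral_comp_smul, finrank_euclideanSpace_fin, abs_of_pos (by positivity),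
    Complex.real_smul, ← mul_assoc, ← Complex.ofReal_mul, mul_inv_cancel₀ (by positivity)]
  simp

theorem sympFourier_dilate {ε : ℝ} (hε : ε ≠ 0) (χ : 𝓢(Phase, ℂ)) (y : Phase) :
    ((ε ^ 2 : ℝ) : ℂ) * sympFourier hħ (dilate ε χ) (ε • y) = sympFourier hħ χ y := by
  rw [sympFourier_eq_integral, sympFourier_eq_integral, mul_left_comm]
  congr 1
  rw [integral_comp_smul_phase hε fun w => character (phaseForm ħ w) y * χ w]
  congr 1
  refine integral_congr_ae (Eventually.of_forall fun w => ?_)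
  simp only [dilate_apply hε, character, map_smul, smul_apply]

theorem tendsto_map_smulLeftCLM_map_modul {n : Phase → ℂ} (hn : n.HasTemperateGrowth)
    {a : 𝓢'(Phase, ℂ)} (ha : sympFourierDist hħ a = hn.toTemperedDistribution volume)
    (T : 𝓢(Phase, ℂ) →L[ℂ] ℂ) (u : 𝓢(Phase, ℂ)) {χ : 𝓢(Phase, ℂ)} (hχ : χ 0 = 1) :
    Tendsto (fun ε => a (SchwartzMap.smulLeftCLM ℂ (fun Ω => T (modul ħ Ω u)) (dilate ε χ)))
      (𝓝[>] 0) (𝓝 (((2 * Real.pi * ħ : ℝ) : ℂ) * T (SchwartzMap.smulLeftCLM ℂ n u))) := by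
  -- With `η = F_σ(χ(ε ·))` and the substitution `y ↦ ε y`, the dependence on `ε` is confined to the
  -- translation parameter.
  have h1 : ∀ ε : ℝ, ε ≠ 0 →
      a (SchwartzMap.smulLeftCLM ℂ (fun Ω => T (modul ħ Ω u)) (dilate ε χ))
        = ∫ y, sympFourier hħ χ y * T (mulTranslate n u (ε • y)) := by
    intro ε hε
    rw [← sympFourier_sympFourier hħ (dilate ε χ), map_smulLeftCLM_map_modul hħ hn ha T u _ hχ,
      integral_comp_smul_phase hε, ← integral_const_mul]
    refine integral_congr_ae (Eventually.of_forall fun y => ?_)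
    simp only [← sympFourier_dilate hħ hε χ, mul_assoc]
  have hcont : Continuous fun y => T (mulTranslate n u y) :=
    T.continuous.comp (continuous_mulTranslate n u)
  -- The total mass of `F_σ χ` is `2πħ χ(0) = 2πħ`, the constant in the definition of the
  -- convolution.
  have h2 : ((2 * Real.pi * ħ : ℝ) : ℂ) * T (SchwartzMap.smulLeftCLM ℂ n u)
      = ∫ y, sympFourier hħ χ y * T (mulTranslate n u 0) := by
    rw [integral_mul_const, integral_sympFourier, hχ, mul_one, mulTranslate_zero hn]
  rw [h2]
  obtain ⟨C, hC, N, h⟩ := exists_norm_map_mulTranslate_le T (n := n) u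
  have h3 : Tendsto (fun ε : ℝ => ∫ y, sympFourier hħ χ y * T (mulTranslate n u (ε • y)))
      (𝓝[>] 0) (𝓝 (∫ y, sympFourier hħ χ y * T (mulTranslate n u 0))) := by
    refine tendsto_integral_filter_of_dominated_convergence
      (fun y => C * ((1 + ‖y‖) ^ N * ‖sympFourier hħ χ y‖)) (Eventually.of_forall fun ε => ?_) ?_
      ((integrable_one_add_norm_pow_mul _ N).const_mul C)
      (Eventually.of_forall fun y => ?_)
    · exact ((sympFourier hħ χ).continuous.mul
        (hcont.comp (continuous_const_smul ε))).aestronglyMeasurable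
    · filter_upwards [Ioc_mem_nhdsGT one_pos] with ε hε
      refine Eventually.of_forall fun y => ?_
      rw [norm_mul]
      have hy : ‖ε • y‖ ≤ ‖y‖ := by
        rw [norm_smul, Real.norm_of_nonneg hε.1.le]
        exact mul_le_of_le_one_left (norm_nonneg y) hε.2
      calc _ ≤ ‖sympFourier hħ χ y‖ * (C * (1 + ‖ε • y‖) ^ N) := by gcongr; exact h _
        _ ≤ ‖sympFourier hħ χ y‖ * (C * (1 + ‖y‖) ^ N) := by gcongr
        _ = _ := by ring
    · have hy : Continuous fun ε : ℝ => T (mulTranslate n u (ε • y)) :=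
        hcont.comp (continuous_id.smul continuous_const)
      have := (hy.tendsto 0).const_mul (sympFourier hħ χ y)
      rw [zero_smul] at this
      exact this.mono_left nhdsWithin_le_nhds
  refine h3.congr' ?_
  filter_upwards [self_mem_nhdsWithin] with ε hε
  exact (h1 ε (ne_of_gt hε)).symm

/-- The analytic core. If `F_σ a` is the slowly increasing one, the concentration argument applies;
if `F_σ S` is, the integrand is a Schwartz function and the cut-offs converge in the Schwartz
topology. -/
theorem hasPhaseIntegral_conv {a S : 𝓢'(Phase, ℂ)} (h : Convolvable hħ a S) (g : 𝓢(Phase, ℂ)) :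
    HasPhaseIntegral a (fun Ω => S (translate (-Ω) g)) (conv hħ a S g) := by
  simp only [map_translate_eq hħ]
  refine ⟨hasTemperateGrowth_map_modul ħ (sympFourierDist hħ S : 𝓢(Phase, ℂ) →L[ℂ] ℂ) _,
    fun χ hχ => ?_⟩
  rcases h with ⟨n, hn, ha⟩ | ⟨m, hm, hS⟩
  · rw [conv_apply_of_left hħ hn ha]
    exact tendsto_map_smulLeftCLM_map_modul hħ hn ha
      (sympFourierDist hħ S : 𝓢(Phase, ℂ) →L[ℂ] ℂ) _ hχ
  · rw [conv_apply_of_right hħ hm hS, ← smul_eq_mul, ← map_smul]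
    set G : 𝓢(Phase, ℂ) := ((2 * Real.pi * ħ : ℝ) : ℂ) • reflect (sympFourier hħ
      (SchwartzMap.smulLeftCLM ℂ m (reflect (sympFourier hħ g)))) with hG
    have hfun : (fun Ω => sympFourierDist hħ S (modul ħ Ω (reflect (sympFourier hħ g))))
        = (G : Phase → ℂ) := funext fun Ω => map_modul_of_eq hħ hm hS _ Ω
    rw [hfun]
    have hcomm : ∀ ε, SchwartzMap.smulLeftCLM ℂ G (dilate ε χ)
        = SchwartzMap.smulLeftCLM ℂ (dilate ε χ) G := by
      intro ε
      ext z
      rw [SchwartzMap.smulLeftCLM_apply_apply G.hasTemperateGrowth,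
        SchwartzMap.smulLeftCLM_apply_apply (dilate ε χ).hasTemperateGrowth, smul_eq_mul,
        smul_eq_mul, mul_comm]
    simp only [hcomm]
    exact (a.continuous.tendsto _).comp (tendsto_smulLeftCLM_dilate χ hχ G)

theorem opCohen_apply (θ a : 𝓢'(Phase, ℂ)) (ψ φ : 𝓢(ℝ, ℂ)) :
    opCohen hħ θ a ψ φ =
      (((Real.pi * ħ)⁻¹ : ℝ) : ℂ) * conv hħ a (reflectDist θ) (grForm hħ ψ φ) := rfl

/-- Transfers the hypothesis on `θ` to `θ^∨`, the distribution that enters the convolution. -/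
theorem IsSlowlyIncreasing.sympFourierDist_reflectDist {θ : 𝓢'(Phase, ℂ)}
    (h : IsSlowlyIncreasing (sympFourierDist hħ θ)) :
    IsSlowlyIncreasing (sympFourierDist hħ (reflectDist θ)) := by
  obtain ⟨m, hm, hθ⟩ := h
  have hm' : (fun z : Phase => m (-z)).HasTemperateGrowth :=
    hm.comp (-ContinuousLinearMap.id ℝ Phase).hasTemperateGrowth
  refine ⟨_, hm', ?_⟩
  ext u
  have h1 : sympFourierDist hħ (reflectDist θ) u = sympFourierDist hħ θ (reflect u) := by
    rw [sympFourierDist_apply, sympFourierDist_apply, reflectDist_apply, sympFourier_reflect]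
  rw [h1, hθ, toTemperedDistribution_eq_integral,
    toTemperedDistribution_eq_integral, ← integral_neg_eq_self]
  simp [reflect_apply]

theorem sympFourierDist_delta : sympFourierDist hħ (TemperedDistribution.delta 0) =
    (Function.HasTemperateGrowth.const
      (((2 * Real.pi * ħ)⁻¹ : ℝ) : ℂ)).toTemperedDistribution volume := by
  ext u
  rw [sympFourierDist_apply, TemperedDistribution.delta_apply, reflect_apply,
    toTemperedDistribution_eq_integral, neg_zero, sympFourier_eq_integral]
  simp only [character, map_zero, Complex.ofReal_zero, mul_zero, Complex.exp_zero, one_mul]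
  rw [integral_mul_const, mul_comm]

/-- The transform of `δ` is the constant `(2πħ)⁻¹`, which cancels the normalization of the
convolution; the involution property does the rest. -/
theorem conv_delta (S : 𝓢'(Phase, ℂ)) : conv hħ (TemperedDistribution.delta 0) S = S := by
  have hc : (((2 * Real.pi * ħ : ℝ)) : ℂ) ≠ 0 := by exact_mod_cast (by positivity)
  rw [conv, mulDist_of_left _ (sympFourierDist_delta hħ), TemperedDistribution.smulLeftCLM_const,
    map_smul, sympFourierDist_sympFourierDist, Complex.ofReal_inv, smul_inv_smul₀ hc]

/-! ### Quantization through the parity operator -/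

theorem parityCohen_eq_smul_opWeyl (θ : 𝓢'(Phase, ℂ)) :
    parityCohen hħ θ = ((Real.pi * ħ : ℝ) : ℂ) • opWeyl hħ (reflectDist θ) := by
  have hc : ((Real.pi * ħ : ℝ) : ℂ) ≠ 0 := by exact_mod_cast (by positivity)
  rw [opWeyl, Complex.ofReal_inv, smul_inv_smul₀ hc, parityCohen_eq_integralGR]

theorem opCohen_delta (θ : 𝓢'(Phase, ℂ)) :
    opCohen hħ θ (TemperedDistribution.delta 0) = opWeyl hħ (reflectDist θ) := by
  rw [opCohen, conv_delta]

theorem isPhaseIntegral_displaced_parityCohen {θ a : 𝓢'(Phase, ℂ)}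
    (ha : Convolvable hħ a (reflectDist θ)) :
    IsPhaseIntegral a (fun Ω => displaced ħ Ω (parityCohen hħ θ))
      (integralGR hħ (conv hħ a (reflectDist θ))) := by
  intro ψ φ
  simp only [displaced_parityCohen]
  exact hasPhaseIntegral_conv hħ ha (grForm hħ ψ φ)

theorem exists_schwartz_eq_displaced_parityCohen {θ : 𝓢'(Phase, ℂ)}
    (hθ : IsSlowlyIncreasing (sympFourierDist hħ θ)) (a : 𝓢'(Phase, ℂ)) (ψ φ : 𝓢(ℝ, ℂ)) :
    ∃ G : 𝓢(Phase, ℂ), (∀ Ω, G Ω = displaced ħ Ω (parityCohen hħ θ) ψ φ) ∧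
      opCohen hħ θ a ψ φ = (((Real.pi * ħ)⁻¹ : ℝ) : ℂ) * a G := by
  obtain ⟨m, hm, hS⟩ := IsSlowlyIncreasing.sympFourierDist_reflectDist hħ hθ
  refine ⟨((2 * Real.pi * ħ : ℝ) : ℂ) • reflect (sympFourier hħ
    (SchwartzMap.smulLeftCLM ℂ m (reflect (sympFourier hħ (grForm hħ ψ φ))))), fun Ω => ?_, ?_⟩
  · rw [displaced_parityCohen, map_translate_eq hħ, map_modul_of_eq hħ hm hS]
    rfl
  · rw [opCohen_apply, conv_apply_of_right hħ hm hS, map_smul, smul_eq_mul]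

end CohenQuant

/-- Let `θ` be a tempered distribution on the phase space, with quantization `Op_θ` and parity
operator `Π_θ`.
* `Op_θ(a) = (πħ)⁻¹ ∫ a(Ω) D(Ω) Π_θ D(Ω)† dΩ` for every tempered distribution `a` for which the
  convolution `a ∗ θ^∨` is defined.
* If `F_σ θ` is slowly increasing, then `a` is an arbitrary tempered distribution and no
  regularization is needed: the matrix elements of `D(Ω) Π_θ D(Ω)†` are Schwartz functions of `Ω`
  and the integral is the value of `a` at them.
* `Π_θ = πħ Op_θ(δ) = πħ Op_Weyl(θ^∨)`. -/
theorem mainTheorem9 (ħ : ℝ) (hħ : 0 < ħ) (θ : 𝓢'(CohenQuant.Phase, ℂ)) :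
    (∀ a : 𝓢'(CohenQuant.Phase, ℂ), CohenQuant.Convolvable hħ a (CohenQuant.reflectDist θ) →
      ∃ B : CohenQuant.Op,
        CohenQuant.IsPhaseIntegral a
          (fun Ω => CohenQuant.displaced ħ Ω (CohenQuant.parityCohen hħ θ)) B ∧
        CohenQuant.opCohen hħ θ a = (((Real.pi * ħ)⁻¹ : ℝ) : ℂ) • B) ∧
    (CohenQuant.IsSlowlyIncreasing (CohenQuant.sympFourierDist hħ θ) →
      ∀ (a : 𝓢'(CohenQuant.Phase, ℂ)) (ψ φ : 𝓢(ℝ, ℂ)), ∃ G : 𝓢(CohenQuant.Phase, ℂ),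
        (∀ Ω, G Ω = CohenQuant.displaced ħ Ω (CohenQuant.parityCohen hħ θ) ψ φ) ∧
        CohenQuant.opCohen hħ θ a ψ φ = (((Real.pi * ħ)⁻¹ : ℝ) : ℂ) * a G) ∧
    CohenQuant.parityCohen hħ θ =
      ((Real.pi * ħ : ℝ) : ℂ) • CohenQuant.opCohen hħ θ (TemperedDistribution.delta 0) ∧
    CohenQuant.parityCohen hħ θ =
      ((Real.pi * ħ : ℝ) : ℂ) • CohenQuant.opWeyl hħ (CohenQuant.reflectDist θ) :=
  ⟨fun _ ha => ⟨_, CohenQuant.isPhaseIntegral_displaced_parityCohen hħ ha, rfl⟩,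
    fun hθ => CohenQuant.exists_schwartz_eq_displaced_parityCohen hħ hθ,
    by rw [CohenQuant.opCohen_delta, ← CohenQuant.parityCohen_eq_smul_opWeyl],
    CohenQuant.parityCohen_eq_smul_opWeyl hħ θ⟩
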